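/- Let $1 \le k \le n$. Let $G_k(n)$ be the oriented Grassmann manifold of oriented linear $k$-planes in $\mathbb R^n$, with the smooth structure given by the parametrizations $\mathrm{Hom}(u,u^\perp) \to G_k(n)$, $B \mapsto \mathrm{graph}(B)$ (oriented from $u$ by $t\mapsto t+Bt$); they identify $T_uG_k(n)$ with $\mathrm{Hom}(u,u^\perp)$. Let $AG_k(n)$ be the manifold of oriented affine $k$-planes in $\mathbb R^n$, written as pairs $(u,v)$, where $u\in G_k(n)$ is the parallel linear plane and $v \in u^\perp$ is the point of the affine plane nearest to the origin; let $\rho(u,v)=u$, and $\xi_U=\rho^{-1}(U)$ for $U\subset G_k(n)$. Let $\alpha : AG_k(n) \to G_{k+1}(n+1)$ be the embedding which sends an affine plane $P$ to the oriented linear $(k+1)$-plane spanned by $P\times\{1\} \subset \mathbb R^n\times\mathbb R=\mathbb R^{n+1}$. The bad cone $\mathscr B_u$ at a plane $u$ of an oriented Grassmannian is the set of the planes $u'$ of that Grassmannian with $u\cap u' \ne 0$. Two subsets are called transverse at a common point if their tangent spaces (tangent cones) there intersect only in $0$; spanning is not required. For $M\subset AG_k(n)$, we say that $\alpha(M)$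 is transverse to every bad cone if for every $w\in\alpha(M)$ the sets $\alpha(M)$ and $\mathscr B_w$ are transverse at $w$. A smooth fibration of $\mathbb R^n$ by oriented affine $k$-planes is given by a smooth map $\pi:\mathbb R^n\to G_k(n)$ that is constant on the plane $x+\pi(x)$ for every $x$; these planes, oriented by $\pi(x)$, partition $\mathbb R^n$ and are the fibers of the fibration. It is nondegenerate if for every $x\in\mathbb R^n$ the differential $d\pi_x$ is injective on $\pi(x)^\perp$ and $d\pi_x(\pi(x)^\perp)$ meets the tangent cone of $\mathscr B_{\pi(x)}$ at $\pi(x)$ only in $0$ (that is, the restriction of $\pi$ to the affine subspace $x+\pi(x)^\perp$ is at $x$ an immersion transverse to the bad cone $\mathscr B_{\pi(x)}$). Let $M\subset AG_k(n)$ be a smooth (embedded) $(n-k)$-dimensional submanifold. The following are equivalent: (a) $M$ is the set of the fibers of a smooth nondegenerate fibration $\pi$ of $\mathbb R^n$ by oriented affine $k$-planes. (b) $M$ is a closed subset of $AG_k(n)$, $M$ is connected, and $\alpha(M)$ is transverse to every bad cone. (c) There are a connected, contractible, smooth (embedded) submanifold $U\subset G_k(n)$ and a smooth section $U\to\xi_U$,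 $u\mapsto(u,v(u))$, with image $M$, such that $\alpha(M)$ is transverse to every bad cone and such that $|v(u_i)|\to\infty$ for every sequence $(u_i)$ in $U$ with $u_i\to\partial U$, where $\partial U=\overline U\setminus U$. Connected spaces are understood to be nonempty. -/

import Mathlib

open Set Filter Topology
open scoped ContDiff

noncomputable section

variable {k : ℕ} {V : Type*} [NormedAddCommGroup V] [InnerProductSpace ℝ V]

/-! ### The oriented Grassmann manifold -/

/-- The oriented Grassmannian: oriented linear `k`-dimensional subspaces of the (finite-dimensional)
Euclidean space `V`. -/
structure OrientedGrassmannian (k : ℕ) (V : Type*) [NormedAddCommGroup V]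
    [InnerProductSpace ℝ V] where
  /-- the underlying linear subspace -/
  plane : Submodule ℝ V
  finrank_plane : Module.finrank ℝ plane = k
  /-- the orientation of the subspace -/
  orientation : Orientation ℝ plane (Fin k)

namespace OrientedGrassmannian

/-- The linear map `u → V`, `t ↦ t + B t`, whose range is the graph of `B : u → uᗮ`. -/
def graphMap (u : OrientedGrassmannian k V) (B : u.plane →L[ℝ] u.planeᗮ) : u.plane →ₗ[ℝ] V :=
  u.plane.subtype + u.planeᗮ.subtype ∘ₗ B.toLinearMap

@[simp]
theorem graphMap_apply (u : OrientedGrassmannian k V) (B : u.plane →L[ℝ] u.planeᗮ)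
    (t : u.plane) : u.graphMap B t = (t : V) + (B t : V) := rfl

theorem eq_of_add_eq_add (K : Submodule ℝ V) {s t : K} {b c : Kᗮ}
    (h : (s : V) + (b : V) = (t : V) + (c : V)) : s = t ∧ b = c := by
  have hd : (s : V) - t = (c : V) - b := by
    rw [sub_eq_sub_iff_add_eq_add, h, add_comm]
  have h0 : (s : V) - t ∈ K ⊓ Kᗮ :=
    ⟨K.sub_mem s.2 t.2, hd ▸ Kᗮ.sub_mem c.2 b.2⟩
  rw [Submodule.inf_orthogonal_eq_bot, Submodule.mem_bot] at h0
  refine ⟨Subtype.ext (sub_eq_zero.1 h0), Subtype.ext ?_⟩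
  rw [h0] at hd
  exact (sub_eq_zero.1 hd.symm).symm

theorem graphMap_injective (u : OrientedGrassmannian k V) (B : u.plane →L[ℝ] u.planeᗮ) :
    Function.Injective (u.graphMap B) :=
  fun _ _ h => (eq_of_add_eq_add u.plane h).1

/-- The isomorphism of `u` onto the graph of `B : u → uᗮ`. -/
def graphEquiv (u : OrientedGrassmannian k V) (B : u.plane →L[ℝ] u.planeᗮ) :
    u.plane ≃ₗ[ℝ] LinearMap.range (u.graphMap B) :=
  LinearEquiv.ofInjective (u.graphMap B) (u.graphMap_injective B)

/-- The parametrization `φ : Hom(u, uᗮ) → G_k(V)` of a neighbourhood of `u`: it sends `B` to the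
graph of `B`, with the orientation carried over from `u` by `t ↦ t + B t`. -/
def graphChart (u : OrientedGrassmannian k V) (B : u.plane →L[ℝ] u.planeᗮ) :
    OrientedGrassmannian k V where
  plane := LinearMap.range (u.graphMap B)
  finrank_plane := by rw [← (u.graphEquiv B).finrank_eq, u.finrank_plane]
  orientation := Orientation.map (Fin k) (u.graphEquiv B) u.orientation

theorem graphChart_injective (u : OrientedGrassmannian k V) :
    Function.Injective u.graphChart := by
  intro B C h
  have hp : LinearMap.range (u.graphMap B) = LinearMap.range (u.graphMap C) :=
    congrArg OrientedGrassmannian.plane h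
  ext t
  have ht : u.graphMap B t ∈ LinearMap.range (u.graphMap C) := hp ▸ LinearMap.mem_range_self _ t
  obtain ⟨s, hs⟩ := ht
  obtain ⟨h1, h2⟩ := eq_of_add_eq_add u.plane hs
  rw [h1] at h2
  exact congrArg Subtype.val h2.symm

/-- The manifold topology: a set is open iff its preimage under each of the
parametrizations `graphChart u` is open. -/
instance : TopologicalSpace (OrientedGrassmannian k V) :=
  ⨆ u : OrientedGrassmannian k V, TopologicalSpace.coinduced u.graphChart inferInstance

/-- The chart `φ⁻¹` at `u`, the inverse of `graphChart u` (a junk value outside of the range of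
`graphChart u`). -/
def coord (u : OrientedGrassmannian k V) : OrientedGrassmannian k V → (u.plane →L[ℝ] u.planeᗮ) :=
  Function.invFun u.graphChart

theorem coord_graphChart (u : OrientedGrassmannian k V) (B : u.plane →L[ℝ] u.planeᗮ) :
    u.coord (u.graphChart B) = B :=
  Function.leftInverse_invFun u.graphChart_injective B

section Smooth

variable {E : Type*} [NormedAddCommGroup E] [NormedSpace ℝ E]

/-- A map from a normed space to the oriented Grassmannian is smooth if near every point `x` it
takes values in the domain of the chart at `f x` and is smooth in that chart. -/
def Smooth (f : E → OrientedGrassmannian k V) : Prop :=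
  ∀ x, (∀ᶠ y in 𝓝 x, f y ∈ range (f x).graphChart) ∧
    ContDiffAt ℝ ∞ (fun y => (f x).coord (f y)) x

/-- The differential of `f` at `x`, where the tangent space of the Grassmannian at `u = f x` is
identified with `Hom(u, uᗮ)` by the chart at `u`. -/
def differential (f : E → OrientedGrassmannian k V) (x : E) :
    E →L[ℝ] ((f x).plane →L[ℝ] (f x).planeᗮ) :=
  fderiv ℝ (fun y => (f x).coord (f y)) x

end Smooth

/-- A smooth local parametrization of `U`: a smooth embedding (an immersion which is a homeomorphism
onto its image) of `ℝᵈ` onto a relatively open subset of `U`. -/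
structure IsLocalParametrization {d : ℕ} (U : Set (OrientedGrassmannian k V))
    (f : EuclideanSpace ℝ (Fin d) → OrientedGrassmannian k V) : Prop where
  smooth : Smooth f
  immersion : ∀ y, Function.Injective (differential f y)
  isEmbedding : IsEmbedding f
  range_eq : ∃ O, IsOpen O ∧ range f = U ∩ O

/-- `U` is a smooth (embedded) `d`-dimensional submanifold of the oriented Grassmannian. -/
def IsSmoothSubmanifold (d : ℕ) (U : Set (OrientedGrassmannian k V)) : Prop :=
  ∀ u ∈ U, ∃ f : EuclideanSpace ℝ (Fin d) → OrientedGrassmannian k V,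
    IsLocalParametrization U f ∧ u ∈ range f

/-- The bad cone at `u`: all `u'` which intersect `u` nontrivially. -/
def badCone (u : OrientedGrassmannian k V) : Set (OrientedGrassmannian k V) :=
  {u' | u.plane ⊓ u'.plane ≠ ⊥}

/-- The tangent space (for singular sets: the tangent cone) at `u` of a subset `S` of the oriented
Grassmannian, in the chart at `u`. For an embedded submanifold `S ∋ u` it is the usual
tangent space, as a subset of `T_u G_k(V) = Hom(u, uᗮ)`. -/
def tangentAt (S : Set (OrientedGrassmannian k V)) (u : OrientedGrassmannian k V) :
    Set (u.plane →L[ℝ] u.planeᗮ) :=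
  tangentConeAt ℝ (u.graphChart ⁻¹' S) 0

/-- Two subsets are transverse at a common point `u` if their tangent spaces at `u` intersect only
trivially (they need not span). -/
def TransverseAt (S T : Set (OrientedGrassmannian k V)) (u : OrientedGrassmannian k V) : Prop :=
  tangentAt S u ∩ tangentAt T u ⊆ {0}

end OrientedGrassmannian

/-! ### The oriented affine Grassmann manifold -/

/-- The oriented affine Grassmannian, whose elements are the oriented affine `k`-planes `P`, written
as pairs `(u, v)`: `u` is the oriented linear `k`-plane parallel to `P`, and `v ∈ uᗮ` is the point
of `P` nearest to the origin. -/
structure OrientedAffineGrassmannian (k : ℕ) (V : Type*) [NormedAddCommGroup V]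
    [InnerProductSpace ℝ V] where
  /-- the parallel oriented linear plane -/
  direction : OrientedGrassmannian k V
  /-- the point nearest to the origin -/
  foot : V
  foot_mem : foot ∈ direction.planeᗮ

namespace OrientedAffineGrassmannian

/-- The points of the affine plane `(u, v)`, that is, the set `v + u`. -/
def points (P : OrientedAffineGrassmannian k V) : Set V :=
  {x | x - P.foot ∈ P.direction.plane}

/-- The topology of the total space of the canonical bundle over `G_k(V)`, a subbundle of the
trivial bundle `G_k(V) × V`. -/
instance : TopologicalSpace (OrientedAffineGrassmannian k V) :=
  TopologicalSpace.induced (fun P => (P.direction, P.foot)) inferInstance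

section Smooth

variable {E : Type*} [NormedAddCommGroup E] [NormedSpace ℝ E]

/-- A map to the oriented affine Grassmannian, an embedded submanifold of `G_k(V) × V`, is smooth
if both of its components are. -/
def Smooth (f : E → OrientedAffineGrassmannian k V) : Prop :=
  OrientedGrassmannian.Smooth (fun y => (f y).direction) ∧ ContDiff ℝ ∞ (fun y => (f y).foot)

/-- The differential of `f` at `x`, as a map to `T_u G_k(V) × V`. -/
def differential (f : E → OrientedAffineGrassmannian k V) (x : E) :
    E →L[ℝ] ((f x).direction.plane →L[ℝ] (f x).direction.planeᗮ) × V :=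
  (OrientedGrassmannian.differential (fun y => (f y).direction) x).prod
    (fderiv ℝ (fun y => (f y).foot) x)

end Smooth

/-- A smooth local parametrization of `M`: a smooth embedding (an immersion which is a homeomorphism
onto its image) of `ℝᵈ` onto a relatively open subset of `M`. -/
structure IsLocalParametrization {d : ℕ} (M : Set (OrientedAffineGrassmannian k V))
    (f : EuclideanSpace ℝ (Fin d) → OrientedAffineGrassmannian k V) : Prop where
  smooth : Smooth f
  immersion : ∀ y, Function.Injective (differential f y)
  isEmbedding : IsEmbedding f
  range_eq : ∃ O, IsOpen O ∧ range f = M ∩ O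

/-- `M` is a smooth (embedded) `d`-dimensional submanifold of the oriented affine Grassmannian. -/
def IsSmoothSubmanifold (d : ℕ) (M : Set (OrientedAffineGrassmannian k V)) : Prop :=
  ∀ P ∈ M, ∃ f : EuclideanSpace ℝ (Fin d) → OrientedAffineGrassmannian k V,
    IsLocalParametrization M f ∧ P ∈ range f

/-! ### The embedding `α : AG_k(V) → G_{k+1}(V × ℝ)` -/

/-- The linear map `u × ℝ → V × ℝ`, `(t, s) ↦ (t + s v, s)`, whose range is `α(P)` for
`P = (u, v)`. -/
def coneMap (P : OrientedAffineGrassmannian k V) :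
    P.direction.plane × ℝ →ₗ[ℝ] WithLp 2 (V × ℝ) :=
  (WithLp.linearEquiv 2 ℝ (V × ℝ)).symm.toLinearMap ∘ₗ
    (LinearMap.coprod P.direction.plane.subtype (LinearMap.toSpanSingleton ℝ V P.foot)).prod
      (LinearMap.snd ℝ P.direction.plane ℝ)

theorem coneMap_apply (P : OrientedAffineGrassmannian k V) (t : P.direction.plane) (s : ℝ) :
    P.coneMap (t, s) = WithLp.toLp 2 ((t : V) + s • P.foot, s) := rfl

theorem coneMap_injective (P : OrientedAffineGrassmannian k V) :
    Function.Injective P.coneMap := by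
  rintro ⟨t, s⟩ ⟨t', s'⟩ h
  rw [coneMap_apply, coneMap_apply] at h
  have h' := (WithLp.toLp_injective 2 h)
  rw [Prod.mk.injEq] at h'
  obtain ⟨h1, rfl⟩ := h'
  rw [Subtype.ext (add_right_cancel h1)]

/-- The isomorphism of `u × ℝ` with the plane `α(P)`. -/
def coneEquiv (P : OrientedAffineGrassmannian k V) :
    (P.direction.plane × ℝ) ≃ₗ[ℝ] LinearMap.range P.coneMap :=
  LinearEquiv.ofInjective P.coneMap P.coneMap_injective

/-- For an alternating `k`-form `η` on `K`, the `(k+1)`-form `ds ∧ η` on `K × ℝ`, where `s` is the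
coordinate on `ℝ`. -/
def wedgeForm {K : Submodule ℝ V} (η : K [⋀^Fin k]→ₗ[ℝ] ℝ) :
    (K × ℝ) [⋀^Fin (k + 1)]→ₗ[ℝ] ℝ :=
  AlternatingMap.alternatizeUncurryFin
    ((LinearMap.snd ℝ K ℝ).smulRight (η.compLinearMap (LinearMap.fst ℝ K ℝ)))

theorem wedgeForm_cons {K : Submodule ℝ V} (η : K [⋀^Fin k]→ₗ[ℝ] ℝ) (e : Fin k → K) :
    wedgeForm η (Fin.cons (0, 1) (fun i => (e i, 0))) = η e := by
  rw [wedgeForm, AlternatingMap.alternatizeUncurryFin_apply, Fin.sum_univ_succ]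
  simp

theorem wedgeForm_ne_zero {K : Submodule ℝ V} {η : K [⋀^Fin k]→ₗ[ℝ] ℝ} (hη : η ≠ 0) :
    wedgeForm η ≠ 0 := by
  intro h
  refine hη (AlternatingMap.ext fun e => ?_)
  rw [← wedgeForm_cons, h]
  rfl

/-- The oriented `(k+1)`-plane in `V × ℝ` spanned by `P × {1}`. If `e₁, …, e_k` is a positive basis
of `P`, then `(v, 1), (e₁, 0), …, (e_k, 0)` is a positive basis of `α(P)`. -/
def alpha [FiniteDimensional ℝ V] (P : OrientedAffineGrassmannian k V) :
    OrientedGrassmannian (k + 1) (WithLp 2 (V × ℝ)) where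
  plane := LinearMap.range P.coneMap
  finrank_plane := by
    rw [← P.coneEquiv.finrank_eq, Module.finrank_prod, P.direction.finrank_plane,
      Module.finrank_self]
  orientation := Orientation.map (Fin (k + 1)) P.coneEquiv
    (rayOfNeZero ℝ (wedgeForm P.direction.orientation.someVector)
      (wedgeForm_ne_zero P.direction.orientation.someVector_ne_zero))

/-- `α(P)` meets the affine hyperplane `V × {1}` in `P`. -/
theorem mem_alpha_plane_iff [FiniteDimensional ℝ V] (P : OrientedAffineGrassmannian k V) (x : V) :
    WithLp.toLp 2 (x, (1 : ℝ)) ∈ P.alpha.plane ↔ x ∈ P.points := by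
  constructor
  · rintro ⟨⟨t, s⟩, h⟩
    rw [coneMap_apply] at h
    have h' := (WithLp.toLp_injective 2 h)
    rw [Prod.mk.injEq] at h'
    obtain ⟨h1, rfl⟩ := h'
    rw [points, mem_ofPred_eq, ← h1, one_smul, add_sub_cancel_right]
    exact t.2
  · intro h
    refine ⟨(⟨x - P.foot, h⟩, 1), ?_⟩
    rw [coneMap_apply, one_smul]
    simp

end OrientedAffineGrassmannian

/-! ### Fibrations by oriented affine planes -/

/-- A smooth fibration of `V` by oriented affine `k`-planes, given by the smooth map `π` which sends
`x` to the oriented linear plane parallel to the fiber through `x`. The fiber through `x` is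
`x + π x`, and `π` is constant on it, so that these planes partition `V`. -/
structure IsSmoothFibration (π : V → OrientedGrassmannian k V) : Prop where
  smooth : OrientedGrassmannian.Smooth π
  eq_of_sub_mem : ∀ x y, y - x ∈ (π x).plane → π y = π x

/-- The fibration `π` is nondegenerate if at every `x` the restriction of `π` to the affine space
`x + (π x)ᗮ` is an immersion at `x` transverse to the bad cone of `π x`: the differential is
injective on `(π x)ᗮ`, and its image there meets the tangent cone of the bad cone only in `0`. -/
def IsNondegenerate (π : V → OrientedGrassmannian k V) : Prop :=
  ∀ x, (∀ ξ ∈ (π x).planeᗮ, OrientedGrassmannian.differential π x ξ = 0 → ξ = 0) ∧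
    (OrientedGrassmannian.differential π x '' ((π x).planeᗮ : Set V)) ∩
      OrientedGrassmannian.tangentAt (π x).badCone (π x) ⊆ {0}

/-- The fibers of `π`, as oriented affine planes: the planes `x + π x`, with the orientation
of `π x`. -/
def fibers (π : V → OrientedGrassmannian k V) : Set (OrientedAffineGrassmannian k V) :=
  {P | ∃ x ∈ P.points, P.direction = π x}

/-- `α(M)` is transverse to every bad cone: at each of its points `w`, it is transverse to the bad
cone of `w`. -/
def AlphaTransverse [FiniteDimensional ℝ V] (M : Set (OrientedAffineGrassmannian k V)) : Prop :=
  ∀ w ∈ OrientedAffineGrassmannian.alpha '' M,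
    OrientedGrassmannian.TransverseAt (OrientedAffineGrassmannian.alpha '' M) w.badCone w

/-- `s` is a smooth section over the `d`-dimensional submanifold `U` of the canonical bundle
`(u, v) ↦ u`. Smoothness is tested in local parametrizations of `U`. -/
structure IsSmoothSection (d : ℕ) (U : Set (OrientedGrassmannian k V))
    (s : U → OrientedAffineGrassmannian k V) : Prop where
  direction_eq : ∀ u, (s u).direction = u
  smooth : ∀ u, ∃ f : EuclideanSpace ℝ (Fin d) → U,
    OrientedGrassmannian.IsLocalParametrization U (fun y => (f y : OrientedGrassmannian k V)) ∧
      u ∈ range f ∧ OrientedAffineGrassmannian.Smooth (fun y => s (f y))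

end

set_option linter.unusedSectionVars false

noncomputable section

/-! An affine plane `P` is replaced by its cone `α(P)` in `V × ℝ`. The vectors `(x, 1)` of the cone
are the points of `P`, the vectors `(e, 0)` its directions, or points at infinity. In the chart at a
plane, the bad cone is the set of noninjective maps, which is its own tangent cone. So
transversality says that a nonzero tangent vector of `α(M)`, as a linear map from `α(P)` to its
complement, kills no nonzero vector (`alphaTransverse_iff`). Equivalently, no nonzero point of a
moving cone has velocity tangent to the cone (`velocity_notMem`). Since `dim M + (k + 1) = n + 1`,
the total space of the cones is then mapped to `V × ℝ` by a local diffeomorphism away from the zero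
vectors (`exists_equiv_hasFDerivAt_coneTotal`). This is used at height 1 and at height 0.

(b) ⇒ (a), height 1: the pairs of a plane of `M` and a point `x` on it map to `x` by a local
homeomorphism. This map is proper, because `M` is closed and the oriented Grassmannian is compact.
It is thus a covering of the simply connected `V` by a connected space, hence bijective. One plane
passes through each point, and it depends smoothly on the point by the inverse function theorem.

(a) ⇒ (b): the set of fibers is the image of `V`, and it is closed because it is given by the
equation `direction = π foot`. Each tangent vector `D` of `α(M)` is obtained by following any chosen
point of the moving fiber (`IsSmoothFibration.eq_differential_of_mem_tangentAt`). If `D` kills a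
vector of nonzero height, the corresponding point of the fiber stands still, so `D = 0`. If `D`
kills a direction, the foot is followed: its velocity is normal to the fiber, and nondegeneracy
applies.

(a) ⇒ (c), height 0: if `P` and `Q` shared a direction `e`, then for small `s ≠ 0` some plane near
`P` and some plane near `Q` would meet in `s⁻¹ e` (`eq_of_common_direction`). So directions
determine planes, continuously by the same argument, and `M` embeds onto its set `U` of directions.
This `U` is a retract of `V` by `u ↦ v(u)` and `π`. Planes with bounded feet accumulate in the
closed set `M`, so their directions do not tend to `∂U`.

(c) ⇒ (b): the growth of `|v|` at `∂U` makes the image of the section closed. -/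

theorem Orientation.map_map {R M N P ι : Type*} [CommRing R] [PartialOrder R]
    [IsStrictOrderedRing R] [AddCommGroup M] [Module R M] [AddCommGroup N] [Module R N]
    [AddCommGroup P] [Module R P] (e : M ≃ₗ[R] N) (f : N ≃ₗ[R] P) (o : Orientation R M ι) :
    Orientation.map ι f (Orientation.map ι e o) = Orientation.map ι (e.trans f) o := by
  induction o using Module.Ray.ind with
  | h v hv => simp only [Orientation.map_apply]; rfl

/-! ### Oriented planes as images of linear maps: charts, continuity, smoothness -/

namespace OrientedGrassmannian

variable {k : ℕ} {V : Type*} [NormedAddCommGroup V] [InnerProductSpace ℝ V]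
variable {X : Type*} [NormedAddCommGroup X] [NormedSpace ℝ X]
variable {E : Type*} [NormedAddCommGroup E] [NormedSpace ℝ E]

/-- `J` maps the oriented space `(X, o)` isomorphically onto the oriented plane `u`. -/
def IsOrientedImage (J : X → V) (o : Orientation ℝ X (Fin k)) (u : OrientedGrassmannian k V) :
    Prop :=
  ∃ e : X ≃ₗ[ℝ] u.plane, (∀ x, (e x : V) = J x) ∧ Orientation.map (Fin k) e o = u.orientation

theorem IsOrientedImage.mem_plane_iff {J : X → V} {o : Orientation ℝ X (Fin k)}
    {u : OrientedGrassmannian k V} (h : IsOrientedImage J o u) {z : V} :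
    z ∈ u.plane ↔ ∃ x, J x = z := by
  obtain ⟨e, he, -⟩ := h
  constructor
  · intro hz
    exact ⟨e.symm ⟨z, hz⟩, by rw [← he, LinearEquiv.apply_symm_apply]⟩
  · rintro ⟨x, rfl⟩
    exact he x ▸ (e x).2

theorem IsOrientedImage.injective {J : X → V} {o : Orientation ℝ X (Fin k)}
    {u : OrientedGrassmannian k V} (h : IsOrientedImage J o u) : Function.Injective J := by
  obtain ⟨e, he, -⟩ := h
  intro x y hxy
  rw [← he, ← he] at hxy
  exact e.injective (Subtype.ext hxy)

theorem IsOrientedImage.unique {J : X → V} {o : Orientation ℝ X (Fin k)}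
    {u u' : OrientedGrassmannian k V} (h : IsOrientedImage J o u) (h' : IsOrientedImage J o u') :
    u = u' := by
  have hp : u.plane = u'.plane := by
    ext z
    rw [h.mem_plane_iff, h'.mem_plane_iff]
  obtain ⟨p, hu, w⟩ := u
  obtain ⟨p', hu', w'⟩ := u'
  obtain rfl : p = p' := hp
  obtain ⟨e, he, ho⟩ := h
  obtain ⟨e', he', ho'⟩ := h'
  obtain rfl : e = e' := by
    ext x
    rw [he, he']
  obtain rfl : w = w' := ho.symm.trans ho'
  rfl

theorem IsOrientedImage.comp {Y : Type*} [NormedAddCommGroup Y] [NormedSpace ℝ Y] {J : X → V}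
    {o : Orientation ℝ X (Fin k)} {u : OrientedGrassmannian k V} (h : IsOrientedImage J o u)
    (g : Y ≃ₗ[ℝ] X) {o' : Orientation ℝ Y (Fin k)} (ho : Orientation.map (Fin k) g o' = o) :
    IsOrientedImage (fun y => J (g y)) o' u := by
  obtain ⟨e, he, heo⟩ := h
  refine ⟨g.trans e, fun y => he _, ?_⟩
  rw [← Orientation.map_map, ho, heo]

theorem isOrientedImage_subtype (u : OrientedGrassmannian k V) :
    IsOrientedImage (fun t : u.plane => (t : V)) u.orientation u :=
  ⟨LinearEquiv.refl ℝ _, fun _ => rfl, by rw [Orientation.map_refl]; rfl⟩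

/-- `graphEquiv` as an isomorphism onto the plane of the chart value. -/
def chartEquiv (u : OrientedGrassmannian k V) (B : u.plane →L[ℝ] u.planeᗮ) :
    u.plane ≃ₗ[ℝ] (u.graphChart B).plane :=
  u.graphEquiv B

theorem coe_chartEquiv (u : OrientedGrassmannian k V) (B : u.plane →L[ℝ] u.planeᗮ)
    (t : u.plane) : (u.chartEquiv B t : V) = u.graphMap B t := rfl

theorem map_chartEquiv (u : OrientedGrassmannian k V) (B : u.plane →L[ℝ] u.planeᗮ) :
    Orientation.map (Fin k) (u.chartEquiv B) u.orientation = (u.graphChart B).orientation := rfl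

theorem isOrientedImage_graphMap (u : OrientedGrassmannian k V) (B : u.plane →L[ℝ] u.planeᗮ) :
    IsOrientedImage (u.graphMap B) u.orientation (u.graphChart B) :=
  ⟨u.chartEquiv B, u.coe_chartEquiv B, u.map_chartEquiv B⟩

theorem mem_graphChart_plane {u : OrientedGrassmannian k V} {B : u.plane →L[ℝ] u.planeᗮ} {z : V} :
    z ∈ (u.graphChart B).plane ↔ ∃ t : u.plane, (t : V) + B t = z :=
  (isOrientedImage_graphMap u B).mem_plane_iff

theorem graphChart_zero (u : OrientedGrassmannian k V) : u.graphChart 0 = u := by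
  refine (isOrientedImage_graphMap u 0).unique ?_
  convert isOrientedImage_subtype u using 1
  ext t
  simp

theorem coord_self (u : OrientedGrassmannian k V) : u.coord u = 0 := by
  have h := u.coord_graphChart 0
  rwa [graphChart_zero] at h

theorem graphChart_coord {u u' : OrientedGrassmannian k V} (h : u' ∈ range u.graphChart) :
    u.graphChart (u.coord u') = u' := by
  obtain ⟨B, rfl⟩ := h
  rw [coord_graphChart]

theorem self_mem_range_graphChart (u : OrientedGrassmannian k V) : u ∈ range u.graphChart :=
  ⟨0, graphChart_zero u⟩

variable [FiniteDimensional ℝ V]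

theorem orthogonalProjectionOnto_graphMap (u : OrientedGrassmannian k V)
    (B : u.plane →L[ℝ] u.planeᗮ) (t : u.plane) :
    u.plane.orthogonalProjectionOnto (u.graphMap B t) = t := by
  rw [graphMap_apply, map_add]
  simp

theorem orthogonalProjectionOnto_orthogonal_graphMap (u : OrientedGrassmannian k V)
    (B : u.plane →L[ℝ] u.planeᗮ) (t : u.plane) :
    u.planeᗮ.orthogonalProjectionOnto (u.graphMap B t) = B t := by
  rw [graphMap_apply, map_add]
  simp

theorem add_orthogonalProjectionOnto (K : Submodule ℝ V) (z : V) :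
    (K.orthogonalProjectionOnto z : V) + Kᗮ.orthogonalProjectionOnto z = z := by
  simp

/-- When the projection of `J` to `u` is an oriented isomorphism `e`, the point of the image of `J`
over `t` is `J (e⁻¹ t)`, and its normal part is the value of the graph map at `t`.
`IsOrientedImage.exists_equiv` is the converse. -/
theorem isOrientedImage_graphChart_of_equiv {J : X →L[ℝ] V} {o : Orientation ℝ X (Fin k)}
    {u : OrientedGrassmannian k V} (e : X ≃L[ℝ] u.plane)
    (he : ∀ x, e x = u.plane.orthogonalProjectionOnto (J x))
    (ho : Orientation.map (Fin k) e.toLinearEquiv o = u.orientation) :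
    IsOrientedImage J o
      (u.graphChart ((u.planeᗮ.orthogonalProjectionOnto ∘L J) ∘L (e.symm : u.plane →L[ℝ] X))) := by
  refine ⟨e.toLinearEquiv.trans (u.chartEquiv _), fun x => ?_, ?_⟩
  · change u.graphMap _ (e x) = _
    rw [graphMap_apply]
    simp only [ContinuousLinearMap.comp_apply, ContinuousLinearEquiv.coe_coe,
      ContinuousLinearEquiv.symm_apply_apply]
    rw [he, add_orthogonalProjectionOnto]
  · rw [← Orientation.map_map, ho, map_chartEquiv]

theorem IsOrientedImage.exists_equiv {J : X → V} {o : Orientation ℝ X (Fin k)}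
    {u : OrientedGrassmannian k V} {B : u.plane →L[ℝ] u.planeᗮ}
    (h : IsOrientedImage J o (u.graphChart B)) :
    ∃ e : X ≃ₗ[ℝ] u.plane, (∀ x, e x = u.plane.orthogonalProjectionOnto (J x)) ∧
      Orientation.map (Fin k) e o = u.orientation := by
  obtain ⟨e, he, ho⟩ := h
  refine ⟨e.trans (u.chartEquiv B).symm, fun x => ?_, ?_⟩
  · obtain ⟨t, ht⟩ := (u.chartEquiv B).surjective (e x)
    have h1 : J x = u.graphMap B t := by
      rw [← he, ← ht, coe_chartEquiv]
    rw [h1, orthogonalProjectionOnto_graphMap, LinearEquiv.trans_apply]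
    exact (LinearEquiv.symm_apply_eq _).2 ht.symm
  · rw [← Orientation.map_map, ho, ← map_chartEquiv]
    exact (Orientation.map (Fin k) (u.chartEquiv B)).symm_apply_apply _

/-- The coordinate in the chart at `u` of the image of `J`. -/
def imageCoord (u : OrientedGrassmannian k V) (J : X →L[ℝ] V) : u.plane →L[ℝ] u.planeᗮ :=
  (u.planeᗮ.orthogonalProjectionOnto ∘L J) ∘L (u.plane.orthogonalProjectionOnto ∘L J).inverse

end OrientedGrassmannian

/-- The determinant of `e₀⁻¹ A` is 1 at `A = e₀` and stays positive nearby; positivity gives both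
invertibility and the same effect on orientations. -/
theorem eventually_exists_equiv_orientation {k : ℕ} {X Y : Type*} [NormedAddCommGroup X]
    [NormedSpace ℝ X] [FiniteDimensional ℝ X] [NormedAddCommGroup Y] [NormedSpace ℝ Y]
    (hX : Module.finrank ℝ X = k) (o : Orientation ℝ X (Fin k)) (e₀ : X ≃L[ℝ] Y) :
    ∀ᶠ A in 𝓝 (e₀ : X →L[ℝ] Y), ∃ e : X ≃L[ℝ] Y, (e : X →L[ℝ] Y) = A ∧
      Orientation.map (Fin k) e.toLinearEquiv o = Orientation.map (Fin k) e₀.toLinearEquiv o := by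
  have hc : Continuous fun A : X →L[ℝ] Y =>
      ((e₀.symm : Y →L[ℝ] X) ∘L A).det :=
    ContinuousLinearMap.continuous_det.comp (by fun_prop)
  have h0 : 0 < ((e₀.symm : Y →L[ℝ] X) ∘L (e₀ : X →L[ℝ] Y)).det := by
    have : (e₀.symm : Y →L[ℝ] X) ∘L (e₀ : X →L[ℝ] Y) = ContinuousLinearMap.id ℝ X := by
      ext x
      simp
    rw [this]
    simp [ContinuousLinearMap.det]
  filter_upwards [hc.continuousAt.eventually (lt_mem_nhds h0)] with A hA
  set g := LinearMap.equivOfDetNeZero (((e₀.symm : Y →L[ℝ] X) ∘L A : X →L[ℝ] X) : X →ₗ[ℝ] X)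
    hA.ne' with hg
  have hgA : ∀ x, g x = e₀.symm (A x) := fun x => rfl
  refine ⟨g.toContinuousLinearEquiv.trans e₀, ?_, ?_⟩
  · ext x
    simp [hgA]
  · have h1 : Orientation.map (Fin k) g o = o := by
      rw [Orientation.map_eq_iff_det_pos _ _ (by simp [hX])]
      exact hA
    conv_rhs => rw [← h1, Orientation.map_map]
    rfl

namespace OrientedGrassmannian

variable {k : ℕ} {V : Type*} [NormedAddCommGroup V] [InnerProductSpace ℝ V]
  [FiniteDimensional ℝ V]
variable {X : Type*} [NormedAddCommGroup X] [NormedSpace ℝ X]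
variable {E : Type*} [NormedAddCommGroup E] [NormedSpace ℝ E]

theorem IsOrientedImage.finiteDimensional {J : X → V} {o : Orientation ℝ X (Fin k)}
    {u : OrientedGrassmannian k V} (h : IsOrientedImage J o u) : FiniteDimensional ℝ X := by
  obtain ⟨e, -⟩ := h
  exact e.symm.finiteDimensional

theorem IsOrientedImage.finrank_eq {J : X → V} {o : Orientation ℝ X (Fin k)}
    {u : OrientedGrassmannian k V} (h : IsOrientedImage J o u) : Module.finrank ℝ X = k := by
  obtain ⟨e, -⟩ := h
  rw [e.finrank_eq, u.finrank_plane]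

theorem IsOrientedImage.isInvertible {J₀ : X →L[ℝ] V} {o : Orientation ℝ X (Fin k)}
    {u : OrientedGrassmannian k V} {B : u.plane →L[ℝ] u.planeᗮ}
    (h : IsOrientedImage J₀ o (u.graphChart B)) :
    (u.plane.orthogonalProjectionOnto ∘L J₀).IsInvertible := by
  have := h.finiteDimensional
  obtain ⟨e, he, ho⟩ := h.exists_equiv
  exact ⟨e.toContinuousLinearEquiv, by ext x; simp [he]⟩

/-- Planes which are images of maps near `J₀` lie in the chart at `u` if the image of `J₀` does. -/
theorem IsOrientedImage.eventually_graphChart {J₀ : X →L[ℝ] V} {o : Orientation ℝ X (Fin k)}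
    {u : OrientedGrassmannian k V} {B : u.plane →L[ℝ] u.planeᗮ}
    (h : IsOrientedImage J₀ o (u.graphChart B)) :
    ∀ᶠ J : X →L[ℝ] V in 𝓝 J₀, IsOrientedImage J o (u.graphChart (u.imageCoord J)) := by
  have := h.finiteDimensional
  obtain ⟨e₀, he₀, ho₀⟩ := h.exists_equiv
  have hc : Continuous fun J : X →L[ℝ] V => u.plane.orthogonalProjectionOnto ∘L J := by fun_prop
  have h0 : u.plane.orthogonalProjectionOnto ∘L J₀ = (e₀.toContinuousLinearEquiv : X →L[ℝ] u.plane) := by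
    ext x
    simp [he₀]
  have hev := eventually_exists_equiv_orientation h.finrank_eq o e₀.toContinuousLinearEquiv
  rw [← h0] at hev
  filter_upwards [hc.continuousAt.eventually hev] with J hJ
  obtain ⟨e, he, ho⟩ := hJ
  have := isOrientedImage_graphChart_of_equiv (J := J) (o := o) (u := u) e
    (fun x => by rw [← ContinuousLinearEquiv.coe_coe, he]; rfl) (ho.trans ho₀)
  rw [imageCoord, ← he, ContinuousLinearMap.inverse_equiv]
  exact this

theorem IsOrientedImage.imageCoord_eq {J₀ : X →L[ℝ] V} {o : Orientation ℝ X (Fin k)}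
    {u : OrientedGrassmannian k V} {B : u.plane →L[ℝ] u.planeᗮ}
    (h : IsOrientedImage J₀ o (u.graphChart B)) : u.imageCoord J₀ = B :=
  u.graphChart_injective (h.eventually_graphChart.self_of_nhds.unique h)

/-- Inversion of operators is smooth. With `IsOrientedImage.eventually_graphChart`, this reduces
continuity and smoothness of a map to the Grassmannian to those of a lift by linear maps. -/
theorem IsOrientedImage.contDiffAt_imageCoord {J₀ : X →L[ℝ] V} {o : Orientation ℝ X (Fin k)}
    {u : OrientedGrassmannian k V} {B : u.plane →L[ℝ] u.planeᗮ}
    (h : IsOrientedImage J₀ o (u.graphChart B)) :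
    ContDiffAt ℝ ∞ (fun J : X →L[ℝ] V => u.imageCoord J) J₀ := by
  have := h.finiteDimensional
  refine ContDiffAt.clm_comp (contDiff_const.clm_comp contDiff_id).contDiffAt ?_
  exact h.isInvertible.contDiffAt_map_inverse.comp J₀
    (contDiff_const.clm_comp contDiff_id).contDiffAt

/-- The continuous linear map underlying `graphMap`. -/
def graphMapL (u : OrientedGrassmannian k V) (B : u.plane →L[ℝ] u.planeᗮ) : u.plane →L[ℝ] V :=
  u.plane.subtypeL + u.planeᗮ.subtypeL ∘L B

theorem isOrientedImage_graphMapL (u : OrientedGrassmannian k V) (B : u.plane →L[ℝ] u.planeᗮ) :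
    IsOrientedImage (u.graphMapL B) u.orientation (u.graphChart B) :=
  isOrientedImage_graphMap u B

theorem contDiff_graphMapL (u : OrientedGrassmannian k V) :
    ContDiff ℝ ∞ u.graphMapL :=
  contDiff_const.add (contDiff_const.clm_comp contDiff_id)

theorem continuous_graphChart (u : OrientedGrassmannian k V) : Continuous u.graphChart :=
  continuous_iSup_rng (i := u) continuous_coinduced_rng

/-- Openness of an image is tested in every other chart `u'`, where the change of charts is the
continuous map `C ↦ u.imageCoord (u'.graphMapL C)`. -/
theorem isOpenEmbedding_graphChart (u : OrientedGrassmannian k V) :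
    IsOpenEmbedding u.graphChart := by
  refine .of_continuous_injective_isOpenMap u.continuous_graphChart u.graphChart_injective ?_
  intro O hO
  refine isOpen_iSup_iff.2 fun u' => isOpen_coinduced.2 ?_
  rw [isOpen_iff_mem_nhds]
  rintro C ⟨B, hB, hBC⟩
  have h0 : IsOrientedImage (u'.graphMapL C) u'.orientation (u.graphChart B) := by
    rw [hBC]
    exact u'.isOrientedImage_graphMapL C
  have h1 := u'.contDiff_graphMapL.continuous.continuousAt.eventually h0.eventually_graphChart
  have h2 : ∀ᶠ C' in 𝓝 C, u.imageCoord (u'.graphMapL C') ∈ O := by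
    refine u'.contDiff_graphMapL.continuous.continuousAt.eventually
      (p := fun J => u.imageCoord J ∈ O)
      (h0.contDiffAt_imageCoord.continuousAt.eventually_mem (hO.mem_nhds ?_))
    rwa [h0.imageCoord_eq]
  filter_upwards [h1, h2] with C' h1 h2
  exact ⟨_, h2, h1.unique (u'.isOrientedImage_graphMapL C')⟩

theorem IsOrientedImage.eventually_of_graphChart {T : Type*} [TopologicalSpace T] {h : T → X →L[ℝ] V}
    {o : Orientation ℝ X (Fin k)} {f : T → OrientedGrassmannian k V} {x : T}
    {u : OrientedGrassmannian k V} (hc : ContinuousAt h x)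
    (hf : ∀ᶠ y in 𝓝 x, IsOrientedImage (h y) o (f y)) (hu : f x ∈ range u.graphChart) :
    ∀ᶠ y in 𝓝 x, f y = u.graphChart (u.imageCoord (h y)) := by
  obtain ⟨B, hB⟩ := hu
  have h0 : IsOrientedImage (h x) o (u.graphChart B) := hB ▸ hf.self_of_nhds
  filter_upwards [hf, hc.eventually h0.eventually_graphChart] with y h1 h2
  exact h1.unique h2

theorem IsOrientedImage.eventually_mem_range {T : Type*} [TopologicalSpace T] {h : T → X →L[ℝ] V}
    {o : Orientation ℝ X (Fin k)} {f : T → OrientedGrassmannian k V} {x : T}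
    {u : OrientedGrassmannian k V} (hc : ContinuousAt h x)
    (hf : ∀ᶠ y in 𝓝 x, IsOrientedImage (h y) o (f y)) (hu : f x ∈ range u.graphChart) :
    ∀ᶠ y in 𝓝 x, f y ∈ range u.graphChart := by
  filter_upwards [eventually_of_graphChart hc hf hu] with y hy
  exact ⟨_, hy.symm⟩

theorem IsOrientedImage.continuousAt {T : Type*} [TopologicalSpace T] {h : T → X →L[ℝ] V}
    {o : Orientation ℝ X (Fin k)} {f : T → OrientedGrassmannian k V} {x : T}
    (hc : ContinuousAt h x) (hf : ∀ᶠ y in 𝓝 x, IsOrientedImage (h y) o (f y)) :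
    ContinuousAt f x := by
  have h0 : IsOrientedImage (h x) o ((f x).graphChart 0) := by
    rw [graphChart_zero]
    exact hf.self_of_nhds
  have h1 : ContinuousAt (fun y => (f x).graphChart ((f x).imageCoord (h y))) x :=
    (f x).continuous_graphChart.continuousAt.comp
      (ContinuousAt.comp (g := fun J => (f x).imageCoord J)
        h0.contDiffAt_imageCoord.continuousAt hc)
  exact h1.congr ((eventually_of_graphChart hc hf (self_mem_range_graphChart _)).mono
    fun y hy => hy.symm)

theorem IsOrientedImage.contDiffAt_coord {h : E → X →L[ℝ] V}
    {o : Orientation ℝ X (Fin k)} {f : E → OrientedGrassmannian k V} {x : E}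
    {u : OrientedGrassmannian k V} (hc : ContDiffAt ℝ ∞ h x)
    (hf : ∀ᶠ y in 𝓝 x, IsOrientedImage (h y) o (f y)) (hu : f x ∈ range u.graphChart) :
    ContDiffAt ℝ ∞ (fun y => u.coord (f y)) x := by
  have h1 := eventually_of_graphChart hc.continuousAt hf hu
  obtain ⟨B, hB⟩ := hu
  have h0 : IsOrientedImage (h x) o (u.graphChart B) := hB ▸ hf.self_of_nhds
  refine (h0.contDiffAt_imageCoord.comp x hc).congr_of_eventuallyEq ?_
  filter_upwards [h1] with y hy
  rw [hy, coord_graphChart]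
  rfl

/-- Smoothness at a point. -/
def SmoothAt (f : E → OrientedGrassmannian k V) (x : E) : Prop :=
  (∀ᶠ y in 𝓝 x, f y ∈ range (f x).graphChart) ∧
    ContDiffAt ℝ ∞ (fun y => (f x).coord (f y)) x

theorem smooth_iff {f : E → OrientedGrassmannian k V} : Smooth f ↔ ∀ x, SmoothAt f x := Iff.rfl

theorem IsOrientedImage.smoothAt {h : E → X →L[ℝ] V}
    {o : Orientation ℝ X (Fin k)} {f : E → OrientedGrassmannian k V} {x : E}
    (hc : ContDiffAt ℝ ∞ h x) (hf : ∀ᶠ y in 𝓝 x, IsOrientedImage (h y) o (f y)) :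
    SmoothAt f x :=
  ⟨eventually_mem_range hc.continuousAt hf (self_mem_range_graphChart _),
    contDiffAt_coord hc hf (self_mem_range_graphChart _)⟩

/-- The canonical local lift of a smooth map to the oriented Grassmannian. -/
def lift (f : E → OrientedGrassmannian k V) (x y : E) : (f x).plane →L[ℝ] V :=
  (f x).graphMapL ((f x).coord (f y))

theorem SmoothAt.contDiffAt_lift {f : E → OrientedGrassmannian k V} {x : E} (hf : SmoothAt f x) :
    ContDiffAt ℝ ∞ (lift f x) x :=
  (f x).contDiff_graphMapL.contDiffAt.comp x hf.2

theorem SmoothAt.isOrientedImage_lift {f : E → OrientedGrassmannian k V} {x : E}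
    (hf : SmoothAt f x) :
    ∀ᶠ y in 𝓝 x, IsOrientedImage (lift f x y) (f x).orientation (f y) := by
  filter_upwards [hf.1] with y hy
  have := (f x).isOrientedImage_graphMapL ((f x).coord (f y))
  rwa [graphChart_coord hy] at this

theorem SmoothAt.contDiffAt_coord {f : E → OrientedGrassmannian k V} {x : E} (hf : SmoothAt f x)
    {u : OrientedGrassmannian k V} (hu : f x ∈ range u.graphChart) :
    ContDiffAt ℝ ∞ (fun y => u.coord (f y)) x :=
  IsOrientedImage.contDiffAt_coord hf.contDiffAt_lift hf.isOrientedImage_lift hu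

theorem SmoothAt.continuousAt {f : E → OrientedGrassmannian k V} {x : E} (hf : SmoothAt f x) :
    ContinuousAt f x := by
  have h1 : ContinuousAt (fun y => (f x).graphChart ((f x).coord (f y))) x :=
    (f x).continuous_graphChart.continuousAt.comp hf.2.continuousAt
  refine h1.congr ?_
  filter_upwards [hf.1] with y hy
  exact graphChart_coord hy

theorem Smooth.continuous {f : E → OrientedGrassmannian k V} (hf : Smooth f) : Continuous f :=
  continuous_iff_continuousAt.2 fun x => SmoothAt.continuousAt (hf x)

theorem SmoothAt.comp {F : Type*} [NormedAddCommGroup F] [NormedSpace ℝ F]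
    {f : E → OrientedGrassmannian k V} {g : F → E} {z : F} (hf : SmoothAt f (g z))
    (hg : ContDiffAt ℝ ∞ g z) : SmoothAt (fun y => f (g y)) z :=
  ⟨hg.continuousAt.eventually hf.1,
    ContDiffAt.comp (g := fun y => (f (g z)).coord (f y)) z hf.2 hg⟩

theorem SmoothAt.congr {f g : E → OrientedGrassmannian k V} {x : E} (hf : SmoothAt f x)
    (h : g =ᶠ[𝓝 x] f) : SmoothAt g x := by
  have hx : g x = f x := h.self_of_nhds
  refine ⟨?_, ?_⟩
  · filter_upwards [hf.1, h] with y h1 h2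
    rw [hx, h2]
    exact h1
  · have h1 : ContDiffAt ℝ ∞ (fun y => (g x).coord (f y)) x :=
      hf.contDiffAt_coord (hx ▸ self_mem_range_graphChart _)
    exact h1.congr_of_eventuallyEq (by filter_upwards [h] with y hy; rw [hy])

theorem lift_apply (f : E → OrientedGrassmannian k V) (x y : E) (t : (f x).plane) :
    lift f x y t = (t : V) + (f x).coord (f y) t := rfl

theorem lift_self_apply (f : E → OrientedGrassmannian k V) (x : E) (t : (f x).plane) :
    lift f x x t = t := by
  rw [lift_apply, coord_self]
  simp

/-- The derivative of the canonical lift is the differential. -/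
theorem SmoothAt.hasFDerivAt_lift_apply {f : E → OrientedGrassmannian k V} {x : E}
    (hf : SmoothAt f x) (t : (f x).plane) :
    HasFDerivAt (fun y => lift f x y t)
      ((f x).planeᗮ.subtypeL ∘L (ContinuousLinearMap.apply ℝ _ t ∘L differential f x)) x := by
  have h1 : HasFDerivAt (fun y => (f x).coord (f y)) (differential f x) x :=
    (hf.2.differentiableAt (by simp)).hasFDerivAt
  have h2 : HasFDerivAt (fun y => (f x).coord (f y) t)
      (ContinuousLinearMap.apply ℝ _ t ∘L differential f x) x :=
    HasFDerivAt.comp (g := fun B : (f x).plane →L[ℝ] (f x).planeᗮ => B t) x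
      (ContinuousLinearMap.apply ℝ (f x).planeᗮ t).hasFDerivAt h1
  exact (((f x).planeᗮ.subtypeL.hasFDerivAt).comp x h2).const_add (t : V)

end OrientedGrassmannian

/-! ### The orthogonal projection onto a plane; separation and compactness -/

namespace OrientedGrassmannian

open ContinuousLinearMap in
theorem isInvertible_adjoint_comp_self {X V : Type*} [NormedAddCommGroup X]
    [InnerProductSpace ℝ X] [FiniteDimensional ℝ X] [NormedAddCommGroup V] [InnerProductSpace ℝ V]
    [FiniteDimensional ℝ V] {J : X →L[ℝ] V} (hJ : Function.Injective J) :
    (adjoint J ∘L J).IsInvertible := by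
  have hinj : Function.Injective ((adjoint J ∘L J : X →L[ℝ] X) : X →ₗ[ℝ] X) := by
    rw [injective_iff_map_eq_zero]
    intro x hx
    have h1 : inner ℝ (J x) (J x) = 0 := by
      rw [← adjoint_inner_left]
      change inner ℝ (((adjoint J ∘L J : X →L[ℝ] X) : X →ₗ[ℝ] X) x) x = 0
      rw [hx, inner_zero_left]
    exact hJ (by rw [inner_self_eq_zero.1 h1, map_zero])
  exact ⟨(LinearEquiv.ofInjectiveEndo _ hinj).toContinuousLinearEquiv, by ext x; rfl⟩

variable {k : ℕ} {V : Type*} [NormedAddCommGroup V] [InnerProductSpace ℝ V]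
  [FiniteDimensional ℝ V]
variable {E : Type*} [NormedAddCommGroup E] [NormedSpace ℝ E]

-- The normal equations: the projection is `J (J* J)⁻¹ J*`, which depends smoothly on an injective
-- `J`.
open ContinuousLinearMap in
theorem IsOrientedImage.starProjection_eq {X : Type*} [NormedAddCommGroup X]
    [InnerProductSpace ℝ X] [FiniteDimensional ℝ X] {J : X →L[ℝ] V} {o : Orientation ℝ X (Fin k)}
    {u : OrientedGrassmannian k V} (h : IsOrientedImage J o u) :
    u.plane.starProjection = J ∘L ((adjoint J ∘L J).inverse ∘L adjoint J) := by
  have hi := isInvertible_adjoint_comp_self h.injective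
  ext z
  refine Submodule.eq_starProjection_of_mem_orthogonal (h.mem_plane_iff.2 ⟨_, rfl⟩) ?_
  intro w hw
  obtain ⟨x, rfl⟩ := h.mem_plane_iff.1 hw
  have h1 := hi.self_apply_inverse (adjoint J z)
  rw [comp_apply] at h1
  simp only [comp_apply]
  rw [inner_sub_right, ← adjoint_inner_right, ← adjoint_inner_right J, h1, sub_self]

open ContinuousLinearMap in
theorem IsOrientedImage.contDiffAt_starProjection {X : Type*} [NormedAddCommGroup X]
    [InnerProductSpace ℝ X] {o : Orientation ℝ X (Fin k)} {h : E → X →L[ℝ] V}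
    {f : E → OrientedGrassmannian k V} {x : E} (hc : ContDiffAt ℝ ∞ h x)
    (hf : ∀ᶠ y in 𝓝 x, IsOrientedImage (h y) o (f y)) :
    ContDiffAt ℝ ∞ (fun y => (f y).plane.starProjection) x := by
  have := hf.self_of_nhds.finiteDimensional
  have ha : ContDiffAt ℝ ∞ (fun y => adjoint (h y)) x :=
    (adjoint (𝕜 := ℝ) (E := X) (F := V)).toContinuousLinearEquiv.contDiff.contDiffAt.comp x hc
  have hi := isInvertible_adjoint_comp_self hf.self_of_nhds.injective
  have h1 : ContDiffAt ℝ ∞ (fun y => (adjoint (h y) ∘L h y).inverse) x :=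
    ContDiffAt.comp (g := fun A : X →L[ℝ] X => A.inverse) x hi.contDiffAt_map_inverse
      (ha.clm_comp hc)
  refine (hc.clm_comp (h1.clm_comp ha)).congr_of_eventuallyEq ?_
  filter_upwards [hf] with y hy
  exact hy.starProjection_eq

theorem SmoothAt.contDiffAt_starProjection {f : E → OrientedGrassmannian k V} {x : E}
    (hf : SmoothAt f x) : ContDiffAt ℝ ∞ (fun y => (f y).plane.starProjection) x :=
  IsOrientedImage.contDiffAt_starProjection hf.contDiffAt_lift hf.isOrientedImage_lift

theorem continuous_starProjection :
    Continuous fun u : OrientedGrassmannian k V => u.plane.starProjection := by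
  refine continuous_iff_continuousAt.2 fun u => ?_
  have h1 : ContinuousAt ((fun u : OrientedGrassmannian k V => u.plane.starProjection) ∘
      u.graphChart) 0 :=
    (IsOrientedImage.contDiffAt_starProjection (h := u.graphMapL)
      u.contDiff_graphMapL.contDiffAt
      (Eventually.of_forall u.isOrientedImage_graphMapL)).continuousAt
  rw [u.isOpenEmbedding_graphChart.continuousAt_iff, graphChart_zero] at h1
  exact h1

theorem mem_plane_iff_starProjection {u : OrientedGrassmannian k V} {z : V} :
    z ∈ u.plane ↔ u.plane.starProjection z = z :=
  Submodule.starProjection_eq_self_iff.symm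

/-- Different planes are separated by their orthogonal projections. For the two orientations of one
plane the chart domains are disjoint: a graph projects to its base by an oriented isomorphism, so it
cannot be an oriented graph over both. -/
instance : T2Space (OrientedGrassmannian k V) := by
  refine ⟨fun u u' hne => ?_⟩
  by_cases hp : u.plane.starProjection = u'.plane.starProjection
  · refine ⟨range u.graphChart, range u'.graphChart, u.isOpenEmbedding_graphChart.isOpen_range,
      u'.isOpenEmbedding_graphChart.isOpen_range, self_mem_range_graphChart u,
      self_mem_range_graphChart u', ?_⟩
    rw [Set.disjoint_left]
    rintro _ ⟨B, rfl⟩ ⟨C, hC⟩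
    have hpl : u.plane = u'.plane := by
      ext z
      rw [mem_plane_iff_starProjection, mem_plane_iff_starProjection, hp]
    obtain ⟨p, hu, w⟩ := u
    obtain ⟨p', hu', w'⟩ := u'
    obtain rfl : p = p' := hpl
    have h1 := isOrientedImage_graphMap ⟨p, hu', w'⟩ C
    rw [hC] at h1
    obtain ⟨e, he, ho⟩ := h1.exists_equiv
    have h2 : e = LinearEquiv.refl ℝ p := by
      ext t
      exact congrArg Subtype.val ((he t).trans
        (orthogonalProjectionOnto_graphMap ⟨p, hu', w'⟩ C t))
    rw [h2, Orientation.map_refl] at ho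
    obtain rfl : w' = w := ho
    exact hne rfl
  · obtain ⟨O, O', hO, hO', hu, hu', hd⟩ := t2_separation hp
    exact ⟨_, _, hO.preimage continuous_starProjection, hO'.preimage continuous_starProjection,
      hu, hu', hd.preimage _⟩

theorem exists_ne_zero (hk : 1 ≤ k) (u : OrientedGrassmannian k V) :
    ∃ e ∈ u.plane, e ≠ 0 := by
  refine (Submodule.ne_bot_iff _).1 fun h => ?_
  have h1 := u.finrank_plane
  rw [h, finrank_bot] at h1
  omega

theorem exists_isOrientedImage {X : Type*} [NormedAddCommGroup X] [NormedSpace ℝ X]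
    (hX : Module.finrank ℝ X = k) {J : X →L[ℝ] V} (hJ : Function.Injective J)
    (o : Orientation ℝ X (Fin k)) : ∃ u, IsOrientedImage J o u :=
  ⟨⟨LinearMap.range (J : X →ₗ[ℝ] V),
    by rw [LinearMap.finrank_range_of_inj hJ, hX],
    Orientation.map (Fin k) (LinearEquiv.ofInjective (J : X →ₗ[ℝ] V) hJ) o⟩,
    LinearEquiv.ofInjective (J : X →ₗ[ℝ] V) hJ, fun _ => rfl, rfl⟩

theorem exists_isometry_isOrientedImage (hk : 1 ≤ k) (u : OrientedGrassmannian k V) :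
    ∃ J : EuclideanSpace ℝ (Fin k) →L[ℝ] V, (∀ x, ‖J x‖ = ‖x‖) ∧
      IsOrientedImage J (EuclideanSpace.basisFun (Fin k) ℝ).toBasis.orientation u := by
  set b := u.orientation.finOrthonormalBasis hk u.finrank_plane with hb
  have ho : b.toBasis.orientation = u.orientation :=
    u.orientation.finOrthonormalBasis_orientation hk u.finrank_plane
  refine ⟨u.plane.subtypeL ∘L (b.repr.symm.toContinuousLinearEquiv : _ →L[ℝ] u.plane),
    fun x => ?_, b.repr.symm.toLinearEquiv, fun x => rfl, ?_⟩
  · exact b.repr.symm.norm_map x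
  · rw [← ho, ← Module.Basis.orientation_map]
    congr 1

/-- The Grassmannian is a continuous image of the compact set of linear isometries from `ℝᵏ` to `V`.
Since `k ≥ 1`, every orientation is that of an orthonormal basis, which makes this map surjective.
-/
theorem compactSpace (hk : 1 ≤ k) : CompactSpace (OrientedGrassmannian k V) := by
  set S : Set (EuclideanSpace ℝ (Fin k) →L[ℝ] V) := {J | ∀ x, ‖J x‖ = ‖x‖} with hS
  have hinj : ∀ J : S, Function.Injective J.1 := fun J => by
    rw [injective_iff_map_eq_zero]
    intro x hx
    rw [← norm_eq_zero, ← J.2 x, hx, norm_zero]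
  have hScl : IsClosed S := by
    rw [hS, ofPred_forall]
    exact isClosed_iInter fun x => isClosed_eq (by fun_prop) continuous_const
  have hSb : S ⊆ Metric.closedBall 0 1 := fun J hJ => by
    rw [mem_closedBall_zero_iff]
    exact J.opNorm_le_bound zero_le_one fun x => by rw [hJ x, one_mul]
  have : ProperSpace (EuclideanSpace ℝ (Fin k) →L[ℝ] V) := FiniteDimensional.proper_real _
  have hSc : IsCompact S := (isCompact_closedBall 0 1).of_isClosed_subset hScl hSb
  have : CompactSpace S := isCompact_iff_compactSpace.1 hSc
  choose φ hφ using fun J : S => exists_isOrientedImage (by simp) (hinj J)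
    (EuclideanSpace.basisFun (Fin k) ℝ).toBasis.orientation
  have hc : Continuous φ := continuous_iff_continuousAt.2 fun J =>
    IsOrientedImage.continuousAt continuous_subtype_val.continuousAt (Eventually.of_forall hφ)
  have hsurj : Function.Surjective φ := fun u => by
    obtain ⟨J, hJ, h⟩ := exists_isometry_isOrientedImage hk u
    exact ⟨⟨J, hJ⟩, (hφ ⟨J, hJ⟩).unique h⟩
  exact hsurj.compactSpace hc

instance : FirstCountableTopology (OrientedGrassmannian k V) := by
  refine ⟨fun u => ?_⟩
  have h := u.isOpenEmbedding_graphChart.map_nhds_eq 0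
  rw [graphChart_zero] at h
  rw [← h]
  infer_instance

end OrientedGrassmannian

/-! ### The oriented affine Grassmannian -/

namespace OrientedAffineGrassmannian

open OrientedGrassmannian

variable {k : ℕ} {V : Type*} [NormedAddCommGroup V] [InnerProductSpace ℝ V]

theorem ext' {P Q : OrientedAffineGrassmannian k V} (h : P.direction = Q.direction)
    (hf : P.foot = Q.foot) : P = Q := by
  cases P
  cases Q
  simp_all

theorem isInducing_prod : IsInducing
    (fun P : OrientedAffineGrassmannian k V => (P.direction, P.foot)) := ⟨rfl⟩

theorem isEmbedding_prod : IsEmbedding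
    (fun P : OrientedAffineGrassmannian k V => (P.direction, P.foot)) :=
  ⟨isInducing_prod, fun _ _ h => ext' (congrArg Prod.fst h) (congrArg Prod.snd h)⟩

theorem continuous_direction :
    Continuous (direction : OrientedAffineGrassmannian k V → OrientedGrassmannian k V) :=
  continuous_fst.comp isInducing_prod.continuous

theorem continuous_foot : Continuous (foot : OrientedAffineGrassmannian k V → V) :=
  continuous_snd.comp isInducing_prod.continuous

theorem foot_mem_points (P : OrientedAffineGrassmannian k V) : P.foot ∈ P.points := by
  rw [points, mem_ofPred_eq, sub_self]
  exact zero_mem _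

theorem eq_of_mem_points {P Q : OrientedAffineGrassmannian k V} (h : P.direction = Q.direction)
    {x : V} (hP : x ∈ P.points) (hQ : x ∈ Q.points) : P = Q := by
  refine ext' h ?_
  have hP' : x - P.foot ∈ P.direction.plane := hP
  have hQ' : x - Q.foot ∈ P.direction.plane := h ▸ hQ
  have h1 : P.foot - Q.foot ∈ P.direction.plane := by
    have := sub_mem hQ' hP'
    rwa [sub_sub_sub_cancel_left] at this
  have h2 : P.foot - Q.foot ∈ P.direction.planeᗮ := sub_mem P.foot_mem (h ▸ Q.foot_mem)
  have h3 : P.foot - Q.foot ∈ P.direction.plane ⊓ P.direction.planeᗮ := ⟨h1, h2⟩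
  rw [Submodule.inf_orthogonal_eq_bot, Submodule.mem_bot] at h3
  exact sub_eq_zero.1 h3

variable [FiniteDimensional ℝ V]
variable {E : Type*} [NormedAddCommGroup E] [NormedSpace ℝ E]

instance : T2Space (OrientedAffineGrassmannian k V) := isEmbedding_prod.t2Space

instance : FirstCountableTopology (OrientedAffineGrassmannian k V) :=
  isInducing_prod.firstCountableTopology

theorem mem_points_iff {P : OrientedAffineGrassmannian k V} {x : V} :
    x ∈ P.points ↔ P.foot + P.direction.plane.starProjection x = x := by
  have h0 : P.direction.plane.starProjection P.foot = 0 := by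
    rw [Submodule.starProjection_apply_eq_zero_iff]
    exact P.foot_mem
  rw [points, mem_ofPred_eq, mem_plane_iff_starProjection, map_sub, h0, sub_zero, eq_sub_iff_add_eq,
    add_comm]

theorem isClosed_mem_points :
    IsClosed {q : OrientedAffineGrassmannian k V × V | q.2 ∈ q.1.points} := by
  simp only [mem_points_iff]
  refine isClosed_eq ?_ continuous_snd
  exact (continuous_foot.comp continuous_fst).add
    ((continuous_starProjection.comp (continuous_direction.comp continuous_fst)).clm_apply
      continuous_snd)

/-- The affine plane through `x` with a given direction. -/
def through (u : OrientedGrassmannian k V) (x : V) : OrientedAffineGrassmannian k V :=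
  ⟨u, x - u.plane.starProjection x, Submodule.sub_starProjection_mem_orthogonal x⟩

theorem mem_points_through (u : OrientedGrassmannian k V) (x : V) : x ∈ (through u x).points := by
  rw [mem_points_iff]
  exact sub_add_cancel _ _

theorem eq_through {P : OrientedAffineGrassmannian k V} {x : V} (h : x ∈ P.points) :
    P = through P.direction x :=
  eq_of_mem_points rfl h (mem_points_through _ x)

theorem Smooth.continuous {f : E → OrientedAffineGrassmannian k V} (hf : Smooth f) :
    Continuous f :=
  isInducing_prod.continuous_iff.2 (hf.1.continuous.prodMk hf.2.continuous)

/-! ### Lifting the embedding `α` -/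

/-- The orientation of `K × ℝ` given by the wedge product `ds ∧ η`. -/
def wedgeOrientation {K : Submodule ℝ V} (o : Orientation ℝ K (Fin k)) :
    Orientation ℝ (K × ℝ) (Fin (k + 1)) :=
  rayOfNeZero ℝ (wedgeForm o.someVector) (wedgeForm_ne_zero o.someVector_ne_zero)

theorem wedgeForm_smul {K : Submodule ℝ V} (c : ℝ) (η : K [⋀^Fin k]→ₗ[ℝ] ℝ) :
    wedgeForm (c • η) = c • wedgeForm η := by
  ext x
  simp [wedgeForm, AlternatingMap.alternatizeUncurryFin_apply, Finset.mul_sum]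
  refine Finset.sum_congr rfl fun i _ => ?_
  ring

/-- The arbitrary representative `someVector` is a positive multiple of `η`, and `wedgeForm` is
homogeneous. -/
theorem wedgeOrientation_rayOfNeZero {K : Submodule ℝ V} {η : K [⋀^Fin k]→ₗ[ℝ] ℝ} (hη : η ≠ 0) :
    wedgeOrientation (rayOfNeZero ℝ η hη) = rayOfNeZero ℝ (wedgeForm η) (wedgeForm_ne_zero hη) := by
  have h := Module.Ray.someVector_ray (rayOfNeZero ℝ η hη)
  rw [ray_eq_iff] at h
  obtain ⟨r, hr, hrη⟩ := h.exists_pos_right (Module.Ray.someVector_ne_zero _) hη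
  rw [wedgeOrientation, ray_eq_iff, hrη, wedgeForm_smul]
  exact SameRay.sameRay_pos_smul_left _ hr

theorem map_wedgeOrientation {K L : Submodule ℝ V} (e : K ≃ₗ[ℝ] L) (o : Orientation ℝ K (Fin k)) :
    Orientation.map (Fin (k + 1)) (e.prodCongr (LinearEquiv.refl ℝ ℝ)) (wedgeOrientation o) =
      wedgeOrientation (Orientation.map (Fin k) e o) := by
  induction o using Module.Ray.ind with
  | h η hη =>
    rw [wedgeOrientation_rayOfNeZero, Orientation.map_apply, Orientation.map_apply,
      wedgeOrientation_rayOfNeZero]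
    congr 1
    ext x
    simp [wedgeForm, AlternatingMap.alternatizeUncurryFin_apply]
    rfl

theorem isOrientedImage_coneMap (P : OrientedAffineGrassmannian k V) :
    IsOrientedImage P.coneMap (wedgeOrientation P.direction.orientation) P.alpha :=
  ⟨P.coneEquiv, fun _ => rfl, rfl⟩

/-- The inclusion `V → V × ℝ`. -/
def horizontal (V : Type*) [NormedAddCommGroup V] [InnerProductSpace ℝ V] :
    V →L[ℝ] WithLp 2 (V × ℝ) :=
  ((WithLp.prodContinuousLinearEquiv 2 ℝ V ℝ).symm : V × ℝ →L[ℝ] WithLp 2 (V × ℝ)) ∘L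
    ContinuousLinearMap.inl ℝ V ℝ

theorem horizontal_apply (z : V) : horizontal V z = WithLp.toLp 2 (z, (0 : ℝ)) := rfl

/-- The inclusion of the last coordinate. -/
def vertical (V : Type*) [NormedAddCommGroup V] [InnerProductSpace ℝ V] :
    ℝ →L[ℝ] WithLp 2 (V × ℝ) :=
  ((WithLp.prodContinuousLinearEquiv 2 ℝ V ℝ).symm : V × ℝ →L[ℝ] WithLp 2 (V × ℝ)) ∘L
    ContinuousLinearMap.inr ℝ V ℝ

theorem vertical_apply (s : ℝ) : vertical V s = WithLp.toLp 2 ((0 : V), s) := rfl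

/-- The map `(t, s) ↦ (J t + s v, s)`. -/
def coneLift {X : Type*} [NormedAddCommGroup X] [NormedSpace ℝ X] (J : X →L[ℝ] V) (v : V) :
    X × ℝ →L[ℝ] WithLp 2 (V × ℝ) :=
  horizontal V ∘L (J ∘L ContinuousLinearMap.fst ℝ X ℝ +
    ContinuousLinearMap.smulRightL ℝ (X × ℝ) V (ContinuousLinearMap.snd ℝ X ℝ) v) +
    vertical V ∘L ContinuousLinearMap.snd ℝ X ℝ

theorem coneLift_apply {X : Type*} [NormedAddCommGroup X] [NormedSpace ℝ X] (J : X →L[ℝ] V) (v : V)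
    (t : X) (s : ℝ) : coneLift J v (t, s) = WithLp.toLp 2 (J t + s • v, s) := by
  change horizontal V (J t + s • v) + vertical V s = _
  rw [horizontal_apply, vertical_apply, ← WithLp.toLp_add, Prod.mk_add_mk, add_zero, zero_add]

theorem contDiffAt_coneLift {X : Type*} [NormedAddCommGroup X] [NormedSpace ℝ X]
    {h : E → X →L[ℝ] V} {v : E → V} {x : E} (hh : ContDiffAt ℝ ∞ h x) (hv : ContDiffAt ℝ ∞ v x) :
    ContDiffAt ℝ ∞ (fun y => coneLift (h y) (v y)) x := by
  refine ContDiffAt.add (contDiffAt_const.clm_comp (ContDiffAt.add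
    (hh.clm_comp contDiffAt_const) ?_)) contDiffAt_const
  exact (ContinuousLinearMap.contDiff _).contDiffAt.comp x hv

theorem isOrientedImage_coneLift {P : OrientedAffineGrassmannian k V} {K : Submodule ℝ V}
    {o : Orientation ℝ K (Fin k)} {J : K →L[ℝ] V} (h : IsOrientedImage J o P.direction) :
    IsOrientedImage (coneLift J P.foot) (wedgeOrientation o) P.alpha := by
  obtain ⟨e, he, ho⟩ := h
  have h1 := P.isOrientedImage_coneMap.comp (e.prodCongr (LinearEquiv.refl ℝ ℝ))
    (by rw [map_wedgeOrientation, ho])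
  convert h1 using 1
  ext1 ⟨t, s⟩
  rw [coneLift_apply, LinearEquiv.prodCongr_apply, coneMap_apply, he]
  rfl

theorem mem_alpha_plane {P : OrientedAffineGrassmannian k V} {p : WithLp 2 (V × ℝ)} :
    p ∈ P.alpha.plane ↔ ∃ (t : P.direction.plane) (s : ℝ),
      WithLp.toLp 2 ((t : V) + s • P.foot, s) = p := by
  rw [P.isOrientedImage_coneMap.mem_plane_iff]
  exact Prod.exists

theorem horizontal_mem_alpha_plane {P : OrientedAffineGrassmannian k V} {z : V} :
    horizontal V z ∈ P.alpha.plane ↔ z ∈ P.direction.plane := by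
  rw [mem_alpha_plane]
  constructor
  · rintro ⟨t, s, h⟩
    rw [horizontal_apply] at h
    obtain ⟨h1, rfl⟩ := Prod.mk.inj (WithLp.toLp_injective 2 h)
    rw [← h1, zero_smul, add_zero]
    exact t.2
  · intro hz
    exact ⟨⟨z, hz⟩, 0, by rw [zero_smul, add_zero, horizontal_apply]⟩

end OrientedAffineGrassmannian

/-! ### Tangent spaces and bad cones -/

namespace OrientedGrassmannian

variable {k : ℕ} {V : Type*} [NormedAddCommGroup V] [InnerProductSpace ℝ V]
  [FiniteDimensional ℝ V]
variable {E : Type*} [NormedAddCommGroup E] [NormedSpace ℝ E]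

theorem SmoothAt.hasFDerivAt_coord {g : E → OrientedGrassmannian k V} {x : E} (hg : SmoothAt g x) :
    HasFDerivAt (fun y => (g x).coord (g y)) (differential g x) x :=
  (hg.2.differentiableAt (by simp)).hasFDerivAt

/-- The derivative of a curve of points of moving planes, modulo the plane. -/
theorem SmoothAt.orthogonalProjectionOnto_fderiv {g : E → OrientedGrassmannian k V} {x : E}
    (hg : SmoothAt g x) {p : E → V} {p' : E →L[ℝ] V} (hp : HasFDerivAt p p' x)
    (hmem : ∀ᶠ y in 𝓝 x, p y ∈ (g y).plane) (η : E) (hpx : p x ∈ (g x).plane) :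
    (g x).planeᗮ.orthogonalProjectionOnto (p' η) = differential g x η ⟨p x, hpx⟩ := by
  have h1 : HasFDerivAt (fun y => (g x).planeᗮ.orthogonalProjectionOnto (p y))
      ((g x).planeᗮ.orthogonalProjectionOnto ∘L p') x :=
    (g x).planeᗮ.orthogonalProjectionOnto.hasFDerivAt.comp x hp
  have h2 : HasFDerivAt (fun y => (g x).plane.orthogonalProjectionOnto (p y))
      ((g x).plane.orthogonalProjectionOnto ∘L p') x :=
    (g x).plane.orthogonalProjectionOnto.hasFDerivAt.comp x hp
  have h3 := hg.hasFDerivAt_coord.clm_apply h2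
  have h4 : (fun y => (g x).planeᗮ.orthogonalProjectionOnto (p y)) =ᶠ[𝓝 x]
      fun y => (g x).coord (g y) ((g x).plane.orthogonalProjectionOnto (p y)) := by
    filter_upwards [hg.1, hmem] with y h5 h6
    rw [← graphChart_coord h5, mem_graphChart_plane] at h6
    obtain ⟨t, ht⟩ := h6
    rw [← graphMap_apply] at ht
    rw [← ht, orthogonalProjectionOnto_graphMap, orthogonalProjectionOnto_orthogonal_graphMap]
  have h5 := congrArg (fun L : E →L[ℝ] (g x).planeᗮ => L η)
    (h1.unique (h3.congr_of_eventuallyEq h4))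
  have h6 : (g x).plane.orthogonalProjectionOnto (p x) = ⟨p x, hpx⟩ :=
    Submodule.orthogonalProjectionOnto_mem_subspace_eq_self (⟨p x, hpx⟩ : (g x).plane)
  simpa [coord_self, h6] using h5

theorem SmoothAt.differential_mem_tangentAt {g : E → OrientedGrassmannian k V} {x : E}
    (hg : SmoothAt g x) {S : Set (OrientedGrassmannian k V)} (hS : ∀ᶠ y in 𝓝 x, g y ∈ S) (η : E) :
    differential g x η ∈ tangentAt S (g x) := by
  set N : Set E := {y | g y ∈ range (g x).graphChart ∧ g y ∈ S} with hN
  have hNx : N ∈ 𝓝 x := hg.1.and hS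
  have h0 : HasFDerivWithinAt (fun y => (g x).coord (g y)) (differential g x) N x :=
    hg.hasFDerivAt_coord.hasFDerivWithinAt
  have h1 := HasFDerivWithinAt.mapsTo_tangent_cone (𝕜 := ℝ) (f := fun y => (g x).coord (g y)) h0
  rw [tangentConeAt_of_mem_nhds hNx, coord_self] at h1
  refine tangentConeAt_mono ?_ (h1 (mem_univ η))
  rintro _ ⟨y, hy, rfl⟩
  rw [mem_preimage, graphChart_coord hy.1]
  exact hy.2

theorem graphChart_mem_badCone_iff {u : OrientedGrassmannian k V} {B : u.plane →L[ℝ] u.planeᗮ} :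
    u.graphChart B ∈ u.badCone ↔ ¬ Function.Injective B := by
  rw [badCone, mem_ofPred_eq, injective_iff_map_eq_zero, ne_eq, not_iff_not, Submodule.eq_bot_iff]
  constructor
  · intro h t ht
    have := h t ⟨t.2, mem_graphChart_plane.2 ⟨t, by rw [ht]; simp⟩⟩
    exact Subtype.ext this
  · rintro h z ⟨hz, hz'⟩
    obtain ⟨t, ht⟩ := mem_graphChart_plane.1 hz'
    have h1 : (t : V) + (B t : V) = ((⟨z, hz⟩ : u.plane) : V) + ((0 : u.planeᗮ) : V) := by
      rw [ht]
      simp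
    obtain ⟨h2, h3⟩ := eq_of_add_eq_add u.plane h1
    rw [h t h3] at h2
    exact (congrArg Subtype.val h2).symm

/-- In the chart, the bad cone is the set of noninjective maps. It is closed, because injectivity is
an open condition, and invariant under scaling, so it is its own tangent cone at 0. -/
theorem mem_tangentAt_badCone_iff {u : OrientedGrassmannian k V} {D : u.plane →L[ℝ] u.planeᗮ} :
    D ∈ tangentAt u.badCone u ↔ ¬ Function.Injective D := by
  rw [tangentAt, mem_tangentConeAt_iff_exists_seq]
  constructor
  · rintro ⟨c, d, -, hd, hcd⟩ hD
    have h1 := hcd.eventually_mem (ContinuousLinearMap.isOpen_injective.mem_nhds hD)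
    obtain ⟨i, hi, hi'⟩ := (hd.and h1).exists
    rw [zero_add, mem_preimage, graphChart_mem_badCone_iff] at hi
    exact hi fun s t hst => hi' (by simp [hst])
  · intro hD
    refine ⟨fun i => (i : ℝ) + 1, fun i => ((i : ℝ) + 1)⁻¹ • D, ?_, ?_, ?_⟩
    · have h1 := (tendsto_one_div_add_atTop_nhds_zero_nat (𝕜 := ℝ)).smul_const D
      have h2 : (0 : ℝ) • D = 0 := zero_smul ℝ D
      rw [h2] at h1
      simpa only [one_div] using h1
    · refine Eventually.of_forall fun i => ?_
      have hi : ((i : ℝ) + 1)⁻¹ ≠ 0 := by positivity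
      rw [zero_add, mem_preimage, graphChart_mem_badCone_iff]
      intro h
      refine hD fun s t hst => h ?_
      simp [hst]
    · refine tendsto_const_nhds.congr fun i => ?_
      have hi : (i : ℝ) + 1 ≠ 0 := by positivity
      rw [smul_inv_smul₀ hi]

end OrientedGrassmannian

namespace OrientedAffineGrassmannian

open OrientedGrassmannian

variable {k : ℕ} {V : Type*} [NormedAddCommGroup V] [InnerProductSpace ℝ V]
  [FiniteDimensional ℝ V]
variable {E : Type*} [NormedAddCommGroup E] [NormedSpace ℝ E]

/-- The lift of `α ∘ f` obtained from the canonical lift of the direction of `f`. -/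
def alphaLift (f : E → OrientedAffineGrassmannian k V) (x y : E) :
    (f x).direction.plane × ℝ →L[ℝ] WithLp 2 (V × ℝ) :=
  coneLift (OrientedGrassmannian.lift (fun z => (f z).direction) x y) (f y).foot

theorem Smooth.smoothAt_direction {f : E → OrientedAffineGrassmannian k V} (hf : Smooth f)
    (x : E) : SmoothAt (fun y => (f y).direction) x := hf.1 x

theorem Smooth.contDiffAt_alphaLift {f : E → OrientedAffineGrassmannian k V} (hf : Smooth f)
    (x : E) : ContDiffAt ℝ ∞ (alphaLift f x) x :=
  contDiffAt_coneLift (hf.smoothAt_direction x).contDiffAt_lift hf.2.contDiffAt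

theorem Smooth.isOrientedImage_alphaLift {f : E → OrientedAffineGrassmannian k V} (hf : Smooth f)
    (x : E) : ∀ᶠ y in 𝓝 x, IsOrientedImage (alphaLift f x y)
      (wedgeOrientation (f x).direction.orientation) (f y).alpha := by
  filter_upwards [(hf.smoothAt_direction x).isOrientedImage_lift] with y hy
  exact isOrientedImage_coneLift hy

theorem Smooth.smoothAt_alpha {f : E → OrientedAffineGrassmannian k V} (hf : Smooth f) (x : E) :
    SmoothAt (fun y => (f y).alpha) x :=
  IsOrientedImage.smoothAt (h := alphaLift f x) (hf.contDiffAt_alphaLift x)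
    (hf.isOrientedImage_alphaLift x)

/-- The point `t + s v` of `α(P)` at height `s`. -/
def conePoint (P : OrientedAffineGrassmannian k V) (t : P.direction.plane) (s : ℝ) :
    P.alpha.plane :=
  ⟨WithLp.toLp 2 ((t : V) + s • P.foot, s), mem_alpha_plane.2 ⟨t, s, rfl⟩⟩

theorem conePoint_eq_zero {P : OrientedAffineGrassmannian k V} {t : P.direction.plane} {s : ℝ} :
    P.conePoint t s = 0 ↔ t = 0 ∧ s = 0 := by
  constructor
  · intro h
    have h1 : WithLp.toLp 2 ((t : V) + s • P.foot, s) = WithLp.toLp 2 ((0 : V), (0 : ℝ)) :=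
      congrArg Subtype.val h
    obtain ⟨h2, rfl⟩ := Prod.mk.inj (WithLp.toLp_injective 2 h1)
    rw [zero_smul, add_zero] at h2
    exact ⟨Subtype.ext h2, rfl⟩
  · rintro ⟨rfl, rfl⟩
    refine Subtype.ext ?_
    simp [conePoint]

theorem exists_conePoint {P : OrientedAffineGrassmannian k V} (p : P.alpha.plane) :
    ∃ t s, p = P.conePoint t s := by
  obtain ⟨t, s, h⟩ := mem_alpha_plane.1 p.2
  exact ⟨t, s, Subtype.ext h.symm⟩

/-- The derivative of the direction of `f`, as a map to `Hom(u, uᗮ)`. -/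
def dirDeriv (f : E → OrientedAffineGrassmannian k V) (x : E) :
    E →L[ℝ] ((f x).direction.plane →L[ℝ] (f x).direction.planeᗮ) :=
  OrientedGrassmannian.differential (fun y => (f y).direction) x

/-- The velocity of the point `t + s v` of the moving cone `α ∘ f`. -/
def velocity (f : E → OrientedAffineGrassmannian k V) (x : E) (t : (f x).direction.plane) (s : ℝ) :
    E →L[ℝ] V :=
  (f x).direction.planeᗮ.subtypeL ∘L (ContinuousLinearMap.apply ℝ _ t ∘L dirDeriv f x) +
    s • fderiv ℝ (fun y => (f y).foot) x

theorem velocity_apply (f : E → OrientedAffineGrassmannian k V) (x : E)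
    (t : (f x).direction.plane) (s : ℝ) (η : E) :
    velocity f x t s η = (dirDeriv f x η t : V) + s • fderiv ℝ (fun y => (f y).foot) x η := rfl

/-- The point over `t` at height `s` of the moving cone `α ∘ f`. -/
def movingPoint (f : E → OrientedAffineGrassmannian k V) (x : E) (t : (f x).direction.plane)
    (s : ℝ) (y : E) : V :=
  OrientedGrassmannian.lift (fun z => (f z).direction) x y t + s • (f y).foot

theorem Smooth.hasFDerivAt_movingPoint {f : E → OrientedAffineGrassmannian k V} (hf : Smooth f)
    (x : E) (t : (f x).direction.plane) (s : ℝ) :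
    HasFDerivAt (movingPoint f x t s) (velocity f x t s) x :=
  ((hf.smoothAt_direction x).hasFDerivAt_lift_apply t).add
    ((hf.2.differentiable (by simp) x).hasFDerivAt.const_smul s)

theorem movingPoint_self (f : E → OrientedAffineGrassmannian k V)
    (x : E) (t : (f x).direction.plane) (s : ℝ) :
    movingPoint f x t s x = (t : V) + s • (f x).foot := by
  rw [movingPoint, lift_self_apply]

theorem Smooth.eventually_movingPoint {f : E → OrientedAffineGrassmannian k V} (hf : Smooth f)
    (x : E) : ∀ᶠ y in 𝓝 x, ∀ t s,
      movingPoint f x t s y - s • (f y).foot ∈ (f y).direction.plane := by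
  filter_upwards [(hf.smoothAt_direction x).isOrientedImage_lift] with y hy t s
  rw [movingPoint, add_sub_cancel_right]
  exact hy.mem_plane_iff.2 ⟨t, rfl⟩

theorem Smooth.differential_alpha_conePoint {f : E → OrientedAffineGrassmannian k V}
    (hf : Smooth f) (x : E) (t : (f x).direction.plane) (s : ℝ) (η : E) :
    OrientedGrassmannian.differential (fun y => (f y).alpha) x η ((f x).conePoint t s) =
      (f x).alpha.planeᗮ.orthogonalProjectionOnto (horizontal V (velocity f x t s η)) := by
  have h1 : HasFDerivAt (fun y => horizontal V (movingPoint f x t s y) + vertical V s)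
      (horizontal V ∘L velocity f x t s) x :=
    ((horizontal V).hasFDerivAt.comp x (hf.hasFDerivAt_movingPoint x t s)).add_const _
  have h2 : ∀ y, horizontal V (movingPoint f x t s y) + vertical V s = alphaLift f x y (t, s) := by
    intro y
    rw [alphaLift, coneLift_apply, horizontal_apply, vertical_apply, ← WithLp.toLp_add,
      Prod.mk_add_mk, add_zero, zero_add]
    rfl
  have h3 : ∀ᶠ y in 𝓝 x,
      horizontal V (movingPoint f x t s y) + vertical V s ∈ (f y).alpha.plane := by
    filter_upwards [hf.isOrientedImage_alphaLift x] with y hy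
    rw [h2]
    exact hy.mem_plane_iff.2 ⟨_, rfl⟩
  have h4 := (hf.smoothAt_alpha x).orthogonalProjectionOnto_fderiv h1 h3 η h3.self_of_nhds
  refine Eq.trans ?_ h4.symm
  congr 1
  refine Subtype.ext ?_
  change WithLp.toLp 2 ((t : V) + s • (f x).foot, s) =
    horizontal V (movingPoint f x t s x) + vertical V s
  rw [h2, alphaLift, coneLift_apply, lift_self_apply]

/-- At fixed height the velocity in `V × ℝ` is horizontal, and a horizontal vector lies in `α(P)`
exactly if it is a direction of `P`. -/
theorem Smooth.differential_alpha_eq_zero_iff {f : E → OrientedAffineGrassmannian k V}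
    (hf : Smooth f) (x : E) (t : (f x).direction.plane) (s : ℝ) (η : E) :
    OrientedGrassmannian.differential (fun y => (f y).alpha) x η ((f x).conePoint t s) = 0 ↔
      velocity f x t s η ∈ (f x).direction.plane := by
  rw [hf.differential_alpha_conePoint, Submodule.orthogonalProjectionOnto_eq_zero_iff,
    Submodule.orthogonal_orthogonal, horizontal_mem_alpha_plane]

/-- The velocity of the foot has no component along the plane if the direction is stationary. -/
theorem Smooth.fderiv_foot_mem_orthogonal {f : E → OrientedAffineGrassmannian k V}
    (hf : Smooth f) (x : E) {η : E} (hη : dirDeriv f x η = 0) :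
    fderiv ℝ (fun y => (f y).foot) x η ∈ (f x).direction.planeᗮ := by
  rw [Submodule.mem_orthogonal]
  intro t ht
  have h1 : HasFDerivAt (fun y => (f y).foot) (fderiv ℝ (fun y => (f y).foot) x) x :=
    (hf.2.differentiable (by simp) x).hasFDerivAt
  have h2 := (hf.smoothAt_direction x).hasFDerivAt_lift_apply ⟨t, ht⟩
  have h3 := (h2.inner ℝ h1)
  have h4 : (fun y => inner ℝ (OrientedGrassmannian.lift (fun z => (f z).direction) x y ⟨t, ht⟩)
      (f y).foot) =ᶠ[𝓝 x] fun _ => (0 : ℝ) := by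
    filter_upwards [(hf.smoothAt_direction x).isOrientedImage_lift] with y hy
    exact Submodule.inner_right_of_mem_orthogonal (hy.mem_plane_iff.2 ⟨_, rfl⟩) (f y).foot_mem
  have h5 := congrArg (fun L : E →L[ℝ] ℝ => L η)
    (h3.unique ((hasFDerivAt_const (0 : ℝ) x).congr_of_eventuallyEq h4))
  have h6 : OrientedGrassmannian.differential (fun y => (f y).direction) x η = 0 := hη
  simpa [lift_self_apply, h6] using h5

/-- The embedding `α` is an immersion: the vectors of height 0 detect the derivative of the
direction, and the vector `(v, 1)` then detects that of the foot. -/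
theorem Smooth.differential_eq_zero_of_alpha {f : E → OrientedAffineGrassmannian k V}
    (hf : Smooth f) (x : E) {η : E}
    (h : OrientedGrassmannian.differential (fun y => (f y).alpha) x η = 0) :
    differential f x η = 0 := by
  have hv : ∀ t s, velocity f x t s η ∈ (f x).direction.plane := fun t s => by
    rw [← hf.differential_alpha_eq_zero_iff, h]
    rfl
  have h1 : dirDeriv f x η = 0 := by
    ext t
    have h2 := hv t 0
    rw [velocity_apply, zero_smul, add_zero] at h2
    have h3 : (dirDeriv f x η t : V) ∈ (f x).direction.plane ⊓ (f x).direction.planeᗮ :=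
      ⟨h2, (dirDeriv f x η t).2⟩
    rwa [Submodule.inf_orthogonal_eq_bot, Submodule.mem_bot] at h3
  have h2 : fderiv ℝ (fun y => (f y).foot) x η ∈
      (f x).direction.plane ⊓ (f x).direction.planeᗮ := by
    refine ⟨?_, hf.fderiv_foot_mem_orthogonal x h1⟩
    have h3 := hv 0 1
    rwa [velocity_apply, h1, one_smul, zero_apply, Submodule.coe_zero,
      zero_add] at h3
  rw [Submodule.inf_orthogonal_eq_bot, Submodule.mem_bot] at h2
  exact Prod.ext h1 h2

theorem _root_.alphaTransverse_iff {M : Set (OrientedAffineGrassmannian k V)} :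
    AlphaTransverse M ↔ ∀ P ∈ M, ∀ D ∈ tangentAt (alpha '' M) P.alpha,
      ¬ Function.Injective D → D = 0 := by
  simp only [AlphaTransverse, forall_mem_image, TransverseAt, subset_def, mem_inter_iff,
    mem_tangentAt_badCone_iff, mem_singleton_iff, and_imp]

/-- The moving planes of an immersed family transverse to the bad cones twist: the velocity of no
nonzero point of the cone is tangent to the plane. -/
theorem velocity_notMem {M : Set (OrientedAffineGrassmannian k V)} (hM : AlphaTransverse M)
    {f : E → OrientedAffineGrassmannian k V} (hf : Smooth f) (hfM : ∀ y, f y ∈ M) {x : E}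
    (himm : Function.Injective (differential f x)) {η : E} (hη : η ≠ 0)
    {t : (f x).direction.plane} {s : ℝ} (hts : ¬ (t = 0 ∧ s = 0)) :
    velocity f x t s η ∉ (f x).direction.plane := by
  intro h
  rw [← hf.differential_alpha_eq_zero_iff] at h
  refine hη (himm ?_)
  rw [map_zero]
  refine hf.differential_eq_zero_of_alpha x ?_
  refine alphaTransverse_iff.1 hM _ (hfM x) _ ((hf.smoothAt_alpha x).differential_mem_tangentAt
    (Eventually.of_forall fun y => mem_image_of_mem _ (hfM y)) η) ?_
  intro hinj
  exact hts (conePoint_eq_zero.1 (hinj (h.trans (map_zero _).symm)))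

/-- The total space of the moving cones `α ∘ f`, near `x`, as a map to `V × ℝ`. -/
def coneTotal (f : E → OrientedAffineGrassmannian k V) (x : E)
    (q : E × ((f x).direction.plane × ℝ)) : V × ℝ :=
  (movingPoint f x q.2.1 q.2.2 q.1, q.2.2)

theorem Smooth.contDiffAt_coneTotal {f : E → OrientedAffineGrassmannian k V} (hf : Smooth f)
    (x : E) (q : (f x).direction.plane × ℝ) : ContDiffAt ℝ ∞ (coneTotal f x) (x, q) := by
  have h1 : ContDiffAt ℝ ∞ (fun p : E × ((f x).direction.plane × ℝ) =>
      OrientedGrassmannian.lift (fun z => (f z).direction) x p.1) (x, q) :=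
    ContDiffAt.comp (g := OrientedGrassmannian.lift (fun z => (f z).direction) x) (x, q)
      (hf.smoothAt_direction x).contDiffAt_lift contDiffAt_fst
  have h2 : ContDiff ℝ ∞ (fun p : E × ((f x).direction.plane × ℝ) => (f p.1).foot) :=
    hf.2.comp contDiff_fst
  have h3 : ContDiff ℝ ∞ (fun p : E × ((f x).direction.plane × ℝ) => p.2.2) :=
    contDiff_snd.comp contDiff_snd
  have h4 : ContDiff ℝ ∞ (fun p : E × ((f x).direction.plane × ℝ) => p.2.1) :=
    contDiff_fst.comp contDiff_snd
  exact ((h1.clm_apply h4.contDiffAt).add (h3.smul h2).contDiffAt).prodMk h3.contDiffAt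

theorem Smooth.fderiv_coneTotal {f : E → OrientedAffineGrassmannian k V} (hf : Smooth f)
    (x : E) (t τ : (f x).direction.plane) (s σ : ℝ) (η : E) :
    fderiv ℝ (coneTotal f x) (x, (t, s)) (η, (τ, σ)) =
      (velocity f x t s η + ((τ : V) + σ • (f x).foot), σ) := by
  have h0 : HasFDerivAt (coneTotal f x) (fderiv ℝ (coneTotal f x) (x, (t, s))) (x, (t, s)) :=
    ((hf.contDiffAt_coneTotal x (t, s)).differentiableAt (by simp)).hasFDerivAt
  have h1 : fderiv ℝ (coneTotal f x) (x, (t, s)) (η, (0, 0)) = (velocity f x t s η, 0) := by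
    have h2 : HasFDerivAt (fun y : E => (y, (t, s))) (ContinuousLinearMap.inl ℝ E _) x :=
      hasFDerivAt_prodMk_left x (t, s)
    have h3 : HasFDerivAt (fun y => (movingPoint f x t s y, s))
        ((velocity f x t s).prod (0 : E →L[ℝ] ℝ)) x :=
      (hf.hasFDerivAt_movingPoint x t s).prodMk (hasFDerivAt_const s x)
    have h4 := (HasFDerivAt.comp (g := coneTotal f x) (f := fun y : E => (y, (t, s)))
      x h0 h2).unique h3
    exact congrArg (fun L : E →L[ℝ] V × ℝ => L η) h4
  have h2 : fderiv ℝ (coneTotal f x) (x, (t, s)) (0, (τ, σ)) =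
      ((τ : V) + σ • (f x).foot, σ) := by
    have h2 : HasFDerivAt (fun q : (f x).direction.plane × ℝ => (x, q))
        (ContinuousLinearMap.inr ℝ E _) (t, s) := hasFDerivAt_prodMk_right x (t, s)
    set L : (f x).direction.plane × ℝ →L[ℝ] V × ℝ :=
      ((f x).direction.plane.subtypeL ∘L ContinuousLinearMap.fst ℝ _ ℝ +
        (ContinuousLinearMap.snd ℝ _ ℝ).smulRight (f x).foot).prod
          (ContinuousLinearMap.snd ℝ _ ℝ) with hL
    have h3 : (fun q : (f x).direction.plane × ℝ => coneTotal f x (x, q)) = L := by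
      ext1 q
      exact Prod.ext (movingPoint_self f x q.1 q.2) rfl
    have h4 := HasFDerivAt.comp (g := coneTotal f x)
      (f := fun q : (f x).direction.plane × ℝ => (x, q)) (t, s) h0 h2
    have h5 : HasFDerivAt (coneTotal f x ∘ fun q : (f x).direction.plane × ℝ => (x, q)) L
        (t, s) := by
      rw [show (coneTotal f x ∘ fun q : (f x).direction.plane × ℝ => (x, q)) = L from h3]
      exact L.hasFDerivAt
    exact congrArg (fun L : _ →L[ℝ] V × ℝ => L (τ, σ)) (h4.unique h5)
  have h3 : ((η, (τ, σ)) : E × ((f x).direction.plane × ℝ)) = (η, (0, 0)) + (0, (τ, σ)) := by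
    simp
  rw [h3, map_add, h1, h2, Prod.mk_add_mk, zero_add]

/-- The total space of the cones is locally diffeomorphic to `V × ℝ` away from `0`. -/
theorem exists_equiv_hasFDerivAt_coneTotal [FiniteDimensional ℝ E]
    (hE : Module.finrank ℝ E + k = Module.finrank ℝ V)
    {M : Set (OrientedAffineGrassmannian k V)} (hM : AlphaTransverse M)
    {f : E → OrientedAffineGrassmannian k V} (hf : Smooth f) (hfM : ∀ y, f y ∈ M) {x : E}
    (himm : Function.Injective (differential f x))
    {t : (f x).direction.plane} {s : ℝ} (hts : ¬ (t = 0 ∧ s = 0)) :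
    ∃ e : (E × ((f x).direction.plane × ℝ)) ≃L[ℝ] V × ℝ,
      HasFDerivAt (coneTotal f x) (e : _ →L[ℝ] V × ℝ) (x, (t, s)) := by
  set L := fderiv ℝ (coneTotal f x) (x, (t, s)) with hL
  have hinj : Function.Injective (L : (E × ((f x).direction.plane × ℝ)) →ₗ[ℝ] V × ℝ) := by
    rw [injective_iff_map_eq_zero]
    rintro ⟨η, τ, σ⟩ h
    have h1 : L (η, (τ, σ)) = 0 := h
    rw [hL, hf.fderiv_coneTotal] at h1
    obtain ⟨h2, rfl⟩ := Prod.mk.inj h1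
    rw [zero_smul, add_zero] at h2
    have h3 : velocity f x t s η ∈ (f x).direction.plane := by
      rw [eq_neg_of_add_eq_zero_left h2]
      exact neg_mem τ.2
    have h4 : η = 0 := by
      by_contra hη
      exact velocity_notMem hM hf hfM himm hη hts h3
    subst h4
    rw [map_zero, zero_add] at h2
    have h5 : τ = 0 := Subtype.ext h2
    rw [h5]
    rfl
  have hrank : Module.finrank ℝ (E × ((f x).direction.plane × ℝ)) =
      Module.finrank ℝ (V × ℝ) := by
    simp only [Module.finrank_prod, (f x).direction.finrank_plane]
    omega
  refine ⟨(LinearEquiv.ofInjectiveOfFinrankEq _ hinj hrank).toContinuousLinearEquiv, ?_⟩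
  have h1 : HasFDerivAt (coneTotal f x) L (x, (t, s)) :=
    ((hf.contDiffAt_coneTotal x (t, s)).differentiableAt (by simp)).hasFDerivAt
  have h2 : ((LinearEquiv.ofInjectiveOfFinrankEq _ hinj hrank).toContinuousLinearEquiv :
      _ →L[ℝ] V × ℝ) = L := ContinuousLinearMap.ext fun _ => rfl
  rw [h2]
  exact h1

end OrientedAffineGrassmannian

/-! ### Local structure of a family of planes transverse to the bad cones -/

namespace OrientedAffineGrassmannian

open OrientedGrassmannian

variable {k d : ℕ} {V : Type*} [NormedAddCommGroup V] [InnerProductSpace ℝ V]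
  [FiniteDimensional ℝ V] {M : Set (OrientedAffineGrassmannian k V)}

theorem IsLocalParametrization.mem
    {f : EuclideanSpace ℝ (Fin d) → OrientedAffineGrassmannian k V}
    (hf : IsLocalParametrization M f) (y : EuclideanSpace ℝ (Fin d)) : f y ∈ M := by
  obtain ⟨O, -, hO⟩ := hf.range_eq
  exact (hO ▸ mem_range_self y : f y ∈ M ∩ O).1

theorem IsSmoothSubmanifold.exists_parametrization (hMs : IsSmoothSubmanifold d M)
    {P : OrientedAffineGrassmannian k V} (hP : P ∈ M) :
    ∃ (f : EuclideanSpace ℝ (Fin d) → OrientedAffineGrassmannian k V)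
      (y : EuclideanSpace ℝ (Fin d)), IsLocalParametrization M f ∧ f y = P := by
  obtain ⟨f, hf, y, hy⟩ := hMs P hP
  exact ⟨f, y, hf, hy⟩

/-- A coordinate neighbourhood, as a statement about nearby points of `M`. -/
theorem IsLocalParametrization.eventually_exists
    {f : EuclideanSpace ℝ (Fin d) → OrientedAffineGrassmannian k V}
    (hf : IsLocalParametrization M f) {y : EuclideanSpace ℝ (Fin d)}
    {p : EuclideanSpace ℝ (Fin d) → Prop} (hp : ∀ᶠ z in 𝓝 y, p z) :
    ∀ᶠ Q in 𝓝 (f y), Q ∈ M → ∃ z, f z = Q ∧ p z := by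
  obtain ⟨O, hO, hrange⟩ := hf.range_eq
  have hyO : f y ∈ O := (hrange ▸ mem_range_self y : f y ∈ M ∩ O).2
  rw [hf.isEmbedding.nhds_eq_comap, eventually_comap] at hp
  filter_upwards [hp, hO.mem_nhds hyO] with Q hQ hQO hQM
  obtain ⟨z, rfl⟩ : Q ∈ range f := hrange ▸ ⟨hQM, hQO⟩
  exact ⟨z, rfl, hQ z rfl⟩

theorem finrank_add_eq (hd : d + k = Module.finrank ℝ V) :
    Module.finrank ℝ (EuclideanSpace ℝ (Fin d)) + k = Module.finrank ℝ V := by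
  rw [finrank_euclideanSpace_fin, hd]

/-- The cones over planes of `M` near `P` cover a neighbourhood of each nonzero point of the cone
over `P`. -/
theorem eventually_exists_mem_cone (hMs : IsSmoothSubmanifold d M)
    (hd : d + k = Module.finrank ℝ V) (hM : AlphaTransverse M)
    {P : OrientedAffineGrassmannian k V} (hP : P ∈ M) {x : V} {s : ℝ}
    (hx : x - s • P.foot ∈ P.direction.plane) (h0 : ¬ (x = 0 ∧ s = 0))
    {N : Set (OrientedAffineGrassmannian k V)} (hN : N ∈ 𝓝 P) :
    ∀ᶠ q : V × ℝ in 𝓝 (x, s), ∃ Q ∈ M, Q ∈ N ∧ q.1 - q.2 • Q.foot ∈ Q.direction.plane := by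
  obtain ⟨f, y, hf, rfl⟩ := hMs.exists_parametrization hP
  have hts : ¬ ((⟨x - s • (f y).foot, hx⟩ : (f y).direction.plane) = 0 ∧ s = 0) := by
    rintro ⟨h1, rfl⟩
    refine h0 ⟨?_, rfl⟩
    have h2 := congrArg Subtype.val h1
    simpa using h2
  obtain ⟨e, he⟩ := exists_equiv_hasFDerivAt_coneTotal (finrank_add_eq hd) hM hf.smooth hf.mem
    (hf.immersion y) hts
  have hs := (hf.smooth.contDiffAt_coneTotal y (⟨x - s • (f y).foot, hx⟩, s)).hasStrictFDerivAt'
    he (by simp)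
  have h1 := hs.map_nhds_eq_of_equiv
  have h2 : coneTotal (f) y (y, (⟨x - s • (f y).foot, hx⟩, s)) = (x, s) := by
    refine Prod.ext ?_ rfl
    exact (movingPoint_self f y _ s).trans (sub_add_cancel _ _)
  rw [h2] at h1
  rw [← h1, eventually_map]
  have h3 : ∀ᶠ z in 𝓝 y, f z ∈ N := hf.smooth.continuous.continuousAt.eventually hN
  filter_upwards [continuousAt_fst.eventually (hf.smooth.eventually_movingPoint y),
    continuousAt_fst.eventually h3] with p hp hpN
  exact ⟨f p.1, hf.mem _, hpN, hp _ _⟩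

/-- Locally, at most one plane of `M` near `P` passes through a given point. -/
theorem eventually_unique_mem_points (hMs : IsSmoothSubmanifold d M)
    (hd : d + k = Module.finrank ℝ V) (hM : AlphaTransverse M)
    {P : OrientedAffineGrassmannian k V} (hP : P ∈ M) {x : V} (hx : x ∈ P.points) :
    ∃ N ∈ 𝓝 (P, x), ∀ Q ∈ M, ∀ Q' ∈ M, ∀ z, (Q, z) ∈ N → (Q', z) ∈ N → z ∈ Q.points →
      z ∈ Q'.points → Q = Q' := by
  obtain ⟨f, y, hf, rfl⟩ := hMs.exists_parametrization hP
  set t : (f y).direction.plane := ⟨x - (f y).foot, hx⟩ with ht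
  have hts : ¬ (t = 0 ∧ (1 : ℝ) = 0) := fun h => one_ne_zero h.2
  obtain ⟨e, he⟩ := exists_equiv_hasFDerivAt_coneTotal (finrank_add_eq hd) hM hf.smooth hf.mem
    (hf.immersion y) hts
  have hs := (hf.smooth.contDiffAt_coneTotal y (t, 1)).hasStrictFDerivAt' he (by simp)
  have h1 := hs.eventually_left_inverse
  set L := hs.localInverse (coneTotal f y) e (y, (t, 1)) with hL
  rw [nhds_prod_eq] at h1
  obtain ⟨p, hp, p', hp', hpp⟩ := eventually_prod_iff.1 h1
  have h2 := hf.eventually_exists (hp.and ((hf.smooth.smoothAt_direction y).isOrientedImage_lift))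
  have h3 : ContinuousAt (fun q : OrientedAffineGrassmannian k V × V =>
      ((f y).direction.plane.orthogonalProjectionOnto (q.2 - q.1.foot), (1 : ℝ))) (f y, x) := by
    refine Continuous.continuousAt ?_
    exact ((ContinuousLinearMap.continuous _).comp
      (continuous_snd.sub (continuous_foot.comp continuous_fst))).prodMk continuous_const
  have h4 : (f y).direction.plane.orthogonalProjectionOnto (x - (f y).foot) = t :=
    Submodule.orthogonalProjectionOnto_mem_subspace_eq_self t
  have h5 : ∀ᶠ q : OrientedAffineGrassmannian k V × V in 𝓝 (f y, x),
      p' ((f y).direction.plane.orthogonalProjectionOnto (q.2 - q.1.foot), (1 : ℝ)) :=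
    h3.eventually (by dsimp only; rw [h4]; exact hp')
  -- A plane of `M` near `f y` through a point near `x` is recovered from that point alone, by the
  -- local inverse of `coneTotal` at height 1. Two such planes therefore agree.
  have key : ∀ᶠ q : OrientedAffineGrassmannian k V × V in 𝓝 (f y, x),
      q.1 ∈ M → q.2 ∈ q.1.points → q.1 = f (L (q.2, 1)).1 := by
    filter_upwards [continuousAt_fst.eventually h2, h5] with q hq hq' hqM hqx
    obtain ⟨z, hz, hpz, hzi⟩ := hq hqM
    rw [← hz] at hqx
    obtain ⟨τ, hτ⟩ := hzi.mem_plane_iff.1 hqx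
    have h6 : (f y).direction.plane.orthogonalProjectionOnto (q.2 - q.1.foot) = τ := by
      rw [← hz, ← hτ]
      exact orthogonalProjectionOnto_graphMap (f y).direction _ τ
    rw [h6] at hq'
    have h7 : coneTotal f y (z, (τ, 1)) = (q.2, 1) := by
      refine Prod.ext ?_ rfl
      change OrientedGrassmannian.lift (fun z => (f z).direction) y z τ + (1 : ℝ) • (f z).foot = _
      rw [hτ, one_smul, sub_add_cancel]
    have h8 := hpp hpz hq'
    rw [h7] at h8
    rw [h8, hz]
  refine ⟨_, key, fun Q hQ Q' hQ' z hN hN' hz hz' => ?_⟩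
  exact (hN hQ hz).trans (hN' hQ' hz').symm

/-- Locally, the plane of `M` through a point can be chosen to depend smoothly on the point. -/
theorem exists_smooth_plane_through (hMs : IsSmoothSubmanifold d M)
    (hd : d + k = Module.finrank ℝ V) (hM : AlphaTransverse M)
    {P : OrientedAffineGrassmannian k V} (hP : P ∈ M) {x : V} (hx : x ∈ P.points) :
    ∃ (f : EuclideanSpace ℝ (Fin d) → OrientedAffineGrassmannian k V)
      (g : V → EuclideanSpace ℝ (Fin d)), IsLocalParametrization M f ∧ ContDiffAt ℝ ∞ g x ∧
        f (g x) = P ∧ ∀ᶠ z in 𝓝 x, z ∈ (f (g z)).points := by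
  obtain ⟨f, y, hf, rfl⟩ := hMs.exists_parametrization hP
  set t : (f y).direction.plane := ⟨x - (f y).foot, hx⟩ with ht
  have hts : ¬ (t = 0 ∧ (1 : ℝ) = 0) := fun h => one_ne_zero h.2
  obtain ⟨e, he⟩ := exists_equiv_hasFDerivAt_coneTotal (finrank_add_eq hd) hM hf.smooth hf.mem
    (hf.immersion y) hts
  have hc := hf.smooth.contDiffAt_coneTotal y (t, 1)
  have hs := hc.hasStrictFDerivAt' he (by simp)
  have h0 : coneTotal f y (y, (t, 1)) = (x, 1) := by
    refine Prod.ext ?_ rfl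
    refine (movingPoint_self f y t 1).trans ?_
    rw [one_smul]
    exact sub_add_cancel _ _
  have h1 := hs.eventually_right_inverse
  have h2 := hc.to_localInverse he (by simp)
  have h3 : hs.localInverse (coneTotal f y) e (y, (t, 1)) (coneTotal f y (y, (t, 1))) =
    (y, (t, 1)) := hs.localInverse_apply_image
  change ContDiffAt ℝ ∞ (hs.localInverse (coneTotal f y) e (y, (t, 1))) _ at h2
  set L := hs.localInverse (coneTotal f y) e (y, (t, 1)) with hL
  rw [h0] at h1 h2 h3
  have hι : ContDiffAt ℝ ∞ (fun z : V => (z, (1 : ℝ))) x := contDiffAt_id.prodMk contDiffAt_const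
  have hg : ContDiffAt ℝ ∞ (fun z : V => (L (z, 1)).1) x :=
    contDiffAt_fst.comp x (ContDiffAt.comp (g := L) x h2 hι)
  have hgx : (L (x, 1)).1 = y := by rw [h3]
  refine ⟨f, fun z => (L (z, 1)).1, hf, hg, congrArg f hgx, ?_⟩
  have h4 : ∀ᶠ w in 𝓝 (L (x, 1)).1, ∀ t s,
      movingPoint f y t s w - s • (f w).foot ∈ (f w).direction.plane := by
    rw [hgx]
    exact hf.smooth.eventually_movingPoint y
  filter_upwards [hg.continuousAt.eventually h4, hι.continuousAt.eventually h1] with z hz hz1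
  have h5 := hz (L (z, 1)).2.1 (L (z, 1)).2.2
  have h6 : movingPoint f y (L (z, 1)).2.1 (L (z, 1)).2.2 (L (z, 1)).1 = z :=
    congrArg Prod.fst hz1
  have h7 : (L (z, 1)).2.2 = 1 := congrArg Prod.snd hz1
  rw [h6, h7, one_smul] at h5
  exact h5

end OrientedAffineGrassmannian

/-- A local homeomorphism with compact preimages of compact sets, from a connected Hausdorff
space to a finite-dimensional vector space, is bijective. -/
theorem IsLocalHomeomorph.bijective_of_isCompact_preimage {X V : Type*} [TopologicalSpace X]
    [T2Space X] [ConnectedSpace X] [NormedAddCommGroup V] [NormedSpace ℝ V]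
    [FiniteDimensional ℝ V] {p : X → V} (hp : IsLocalHomeomorph p)
    (hK : ∀ K, IsCompact K → IsCompact (p ⁻¹' K)) : Function.Bijective p := by
  have : ProperSpace V := FiniteDimensional.proper_real V
  have hprop : IsProperMap p := isProperMap_iff_isCompact_preimage.2
    ⟨hp.continuous, fun K hK' => hK K hK'⟩
  -- Fibers are discrete by local injectivity and compact by properness.
  have hfin : ∀ x ∈ (univ : Set V), (p ⁻¹' {x}).Finite := fun x _ =>
    (hK _ isCompact_singleton).finite (IsDiscrete.of_openPartialHomeomorph p subset_rfl
      fun e _ => by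
        obtain ⟨φ, hφ, h⟩ := hp e
        exact ⟨φ, hφ, h.symm⟩)
  have hcov : IsCoveringMap p := isCoveringMap_iff_isCoveringMapOn_univ.2
    (hprop.isClosedMap.isCoveringMapOn_of_isLocalHomeomorphOn hfin hp.isLocalHomeomorphOn)
  obtain ⟨e₀⟩ : Nonempty X := inferInstance
  -- As `V` is simply connected, its identity lifts to a section `g` through `e₀`. Both `g ∘ p` and
  -- the identity of the connected space `X` lift `p` and agree at `e₀`, so they are equal.
  obtain ⟨g, ⟨hg0, hg⟩, -⟩ := hcov.existsUnique_continuousMap_lifts (ContinuousMap.id V) (p e₀) e₀ rfl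
  have hpg : ∀ x, p (g x) = x := fun x => congrFun hg x
  have hgp : (fun e => g (p e)) = id :=
    hcov.eq_of_comp_eq (g.continuous.comp hp.continuous) continuous_id
      (funext fun e => hpg (p e)) e₀ hg0
  exact ⟨fun a b hab => by
    have ha := congrFun hgp a
    have hb := congrFun hgp b
    simp only [id] at ha hb
    rw [← ha, ← hb, hab], fun x => ⟨g x, hpg x⟩⟩

/-! ### A closed connected transverse family is a fibration -/

namespace OrientedAffineGrassmannian

open OrientedGrassmannian

variable {k d : ℕ} {V : Type*} [NormedAddCommGroup V] [InnerProductSpace ℝ V]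
  [FiniteDimensional ℝ V] {M : Set (OrientedAffineGrassmannian k V)}

theorem continuous_through :
    Continuous fun q : OrientedGrassmannian k V × V => through q.1 q.2 :=
  isInducing_prod.continuous_iff.2 (continuous_fst.prodMk
    (continuous_snd.sub ((continuous_starProjection.comp continuous_fst).clm_apply continuous_snd)))

/-- The planes of `M` together with a point on them. -/
def pointedPlanes (M : Set (OrientedAffineGrassmannian k V)) :
    Set (OrientedAffineGrassmannian k V × V) :=
  {q | q.1 ∈ M ∧ q.2 ∈ q.1.points}

/-- A plane is determined by its direction and one of its points, so the preimage is a closed part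
of a continuous image of the product of the compact Grassmannian with `K`. -/
theorem isCompact_preimage_pointedPlanes (hk : 1 ≤ k) (hMc : IsClosed M) {K : Set V}
    (hK : IsCompact K) : IsCompact ((fun q : pointedPlanes M => q.1.2) ⁻¹' K) := by
  have := compactSpace (V := V) hk
  rw [Subtype.isCompact_iff]
  have h1 : IsCompact ((fun q : OrientedGrassmannian k V × V => (through q.1 q.2, q.2)) ''
      (univ ×ˢ K)) :=
    (isCompact_univ.prod hK).image (continuous_through.prodMk continuous_snd)
  refine h1.of_isClosed_subset ?_ ?_
  · have h2 : Subtype.val '' ((fun q : pointedPlanes M => q.1.2) ⁻¹' K) =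
        (Prod.fst ⁻¹' M ∩ {q | q.2 ∈ q.1.points}) ∩ Prod.snd ⁻¹' K := by
      ext q
      constructor
      · rintro ⟨⟨q, hq⟩, hqK, rfl⟩
        exact ⟨hq, hqK⟩
      · rintro ⟨hq, hqK⟩
        exact ⟨⟨q, hq⟩, hqK, rfl⟩
    rw [h2]
    exact ((hMc.preimage continuous_fst).inter isClosed_mem_points).inter
      (hK.isClosed.preimage continuous_snd)
  · rintro _ ⟨⟨⟨P, x⟩, hP, hx⟩, hxK, rfl⟩
    exact ⟨(P.direction, x), ⟨mem_univ _, hxK⟩, Prod.ext (eq_through hx).symm rfl⟩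

/-- Projecting points of `V` onto the planes gives a continuous surjection from `M × V`. -/
theorem connectedSpace_pointedPlanes (hMc : IsConnected M) : ConnectedSpace (pointedPlanes M) := by
  have : ConnectedSpace M := isConnected_iff_connectedSpace.1 hMc
  have hmem : ∀ q : M × V, (q.1.1, q.1.1.foot + q.1.1.direction.plane.starProjection q.2) ∈
      pointedPlanes M := fun q => by
    refine ⟨q.1.2, ?_⟩
    rw [points, mem_ofPred_eq, add_sub_cancel_left]
    exact Submodule.starProjection_apply_mem _ _
  have hsurj : Function.Surjective fun q : M × V =>
      (⟨(q.1.1, q.1.1.foot + q.1.1.direction.plane.starProjection q.2), hmem q⟩ :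
        pointedPlanes M) := by
    rintro ⟨⟨P, x⟩, hP, hx⟩
    refine ⟨(⟨P, hP⟩, x), Subtype.ext (Prod.ext rfl ?_)⟩
    exact mem_points_iff.1 hx
  refine hsurj.connectedSpace (Continuous.subtype_mk ?_ _)
  have h1 : Continuous fun q : M × V => q.1.1 := continuous_subtype_val.comp continuous_fst
  exact h1.prodMk ((continuous_foot.comp h1).add
    ((continuous_starProjection.comp (continuous_direction.comp h1)).clm_apply continuous_snd))

/-- The covering property of the cones at height 1 gives openness, and
`eventually_unique_mem_points` gives local injectivity. -/
theorem isLocalHomeomorph_pointedPlanes (hMs : IsSmoothSubmanifold d M)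
    (hd : d + k = Module.finrank ℝ V) (hM : AlphaTransverse M) :
    IsLocalHomeomorph (fun q : pointedPlanes M => q.1.2) := by
  have hc : Continuous (fun q : pointedPlanes M => q.1.2) :=
    continuous_snd.comp continuous_subtype_val
  have hopen : IsOpenMap (fun q : pointedPlanes M => q.1.2) := by
    rw [isOpenMap_iff_nhds_le]
    rintro ⟨q, hq⟩ S hS
    rw [mem_map, nhds_subtype_eq_comap, mem_comap] at hS
    obtain ⟨T, hT, hTS⟩ := hS
    obtain ⟨P, x⟩ := q
    obtain ⟨hP, hx⟩ := hq
    change T ∈ 𝓝 (P, x) at hT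
    change S ∈ 𝓝 x
    rw [nhds_prod_eq, mem_prod_iff] at hT
    obtain ⟨N, hN, W, hW, hNW⟩ := hT
    have h1 := eventually_exists_mem_cone hMs hd hM hP (x := x) (s := 1)
      (by rw [one_smul]; exact hx) (fun h => one_ne_zero h.2) hN
    have h2 : ContinuousAt (fun z : V => (z, (1 : ℝ))) x := by fun_prop
    filter_upwards [h2.eventually h1, hW] with z hz hzW
    obtain ⟨Q, hQ, hQN, hQz⟩ := hz
    rw [one_smul] at hQz
    exact hTS (a := (⟨(Q, z), hQ, hQz⟩ : pointedPlanes M)) (hNW ⟨hQN, hzW⟩)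
  refine isLocalHomeomorph_iff_isOpenEmbedding_restrict.2 ?_
  rintro ⟨⟨P, x⟩, hP, hx⟩
  obtain ⟨N, hN, hinj⟩ := eventually_unique_mem_points hMs hd hM hP hx
  obtain ⟨N', hN', hN'o, hPN'⟩ := mem_nhds_iff.1 hN
  have hNo : IsOpen ((Subtype.val : pointedPlanes M → _) ⁻¹' N') :=
    hN'o.preimage continuous_subtype_val
  refine ⟨_, hNo.mem_nhds hPN', ?_⟩
  refine .of_continuous_injective_isOpenMap (hc.comp continuous_subtype_val) ?_
    (hopen.comp hNo.isOpenMap_subtype_val)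
  rintro ⟨⟨⟨Q, z⟩, hQ, hz⟩, hQN⟩ ⟨⟨⟨Q', z'⟩, hQ', hz'⟩, hQN'⟩ h
  obtain rfl : z = z' := h
  obtain rfl : Q = Q' := hinj Q hQ Q' hQ' z (hN' hQN) (hN' hQN') hz hz'
  rfl

/-- Exactly one plane of a closed connected transverse family passes through each point. -/
theorem existsUnique_mem_points (hk : 1 ≤ k) (hMs : IsSmoothSubmanifold d M)
    (hd : d + k = Module.finrank ℝ V) (hcl : IsClosed M) (hconn : IsConnected M)
    (hM : AlphaTransverse M) (x : V) : ∃! P, P ∈ M ∧ x ∈ P.points := by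
  have := connectedSpace_pointedPlanes hconn
  obtain ⟨hinj, hsurj⟩ :=
    (isLocalHomeomorph_pointedPlanes hMs hd hM).bijective_of_isCompact_preimage
      fun K hK => isCompact_preimage_pointedPlanes hk hcl hK
  obtain ⟨⟨⟨P, z⟩, hP, hz⟩, rfl⟩ := hsurj x
  refine ⟨P, ⟨hP, hz⟩, fun Q hQ => ?_⟩
  have := hinj (a₁ := ⟨(Q, z), hQ⟩) (a₂ := ⟨(P, z), hP, hz⟩) rfl
  exact congrArg (fun q => q.1.1) this

end OrientedAffineGrassmannian

open OrientedAffineGrassmannian OrientedGrassmannian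

section

variable {k d : ℕ} {V : Type*} [NormedAddCommGroup V] [InnerProductSpace ℝ V]
  [FiniteDimensional ℝ V] {M : Set (OrientedAffineGrassmannian k V)}

/-- The fiber through `x` of the fibration given by `π`. -/
def fiberAt (π : V → OrientedGrassmannian k V) (x : V) : OrientedAffineGrassmannian k V :=
  through (π x) x

theorem smooth_fiberAt {π : V → OrientedGrassmannian k V} (hπ : OrientedGrassmannian.Smooth π) :
    OrientedAffineGrassmannian.Smooth (fiberAt π) := by
  refine ⟨hπ, contDiff_iff_contDiffAt.2 fun x => ?_⟩
  exact contDiffAt_id.sub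
    ((SmoothAt.contDiffAt_starProjection (smooth_iff.1 hπ x)).clm_apply contDiffAt_id)

/-- If the derivative of `π` along a normal vector `ξ` kills a direction `e`, the derivative of `α`
of the fiber kills `(e, 0)` and vanishes by transversality. The fiber is then stationary along `ξ`,
which forces `ξ = 0`. -/
theorem isNondegenerate_of_alphaTransverse (hk : 1 ≤ k) {π : V → OrientedGrassmannian k V}
    (hπ : OrientedGrassmannian.Smooth π) (hM : AlphaTransverse M) (hmem : ∀ x, fiberAt π x ∈ M) :
    IsNondegenerate π := by
  intro x
  have hφ := smooth_fiberAt hπ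
  have key : ∀ ξ ∈ (π x).planeᗮ,
      ¬ Function.Injective (OrientedGrassmannian.differential π x ξ) → ξ = 0 := by
    intro ξ hξ hninj
    have hninj' : ¬ Function.Injective (dirDeriv (fiberAt π) x ξ) := hninj
    rw [injective_iff_map_eq_zero] at hninj'
    push Not at hninj'
    obtain ⟨e, he, he0⟩ := hninj'
    have h1 : velocity (fiberAt π) x e 0 ξ ∈ (fiberAt π x).direction.plane := by
      rw [velocity_apply, zero_smul, add_zero]
      rw [he]
      exact zero_mem _
    rw [← hφ.differential_alpha_eq_zero_iff] at h1
    have h2 : OrientedGrassmannian.differential (fun y => (fiberAt π y).alpha) x ξ = 0 := by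
      refine alphaTransverse_iff.1 hM _ (hmem x) _ ((hφ.smoothAt_alpha x).differential_mem_tangentAt
        (Eventually.of_forall fun y => mem_image_of_mem _ (hmem y)) ξ) fun hinj => ?_
      exact he0 (conePoint_eq_zero.1 (hinj (h1.trans (map_zero _).symm))).1
    have h3 := hφ.differential_eq_zero_of_alpha x h2
    have h4 : dirDeriv (fiberAt π) x ξ = 0 := congrArg Prod.fst h3
    have h5 : fderiv ℝ (fun y => (fiberAt π y).foot) x ξ = 0 := congrArg Prod.snd h3
    -- The vector `y - foot` always lies in the plane `π y`. With direction and foot both stationary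
    -- along `ξ`, its derivative `ξ` must lie in the plane too.
    have h6 : HasFDerivAt (fun y => y - (fiberAt π y).foot)
        (ContinuousLinearMap.id ℝ V - fderiv ℝ (fun y => (fiberAt π y).foot) x) x :=
      (hasFDerivAt_id x).sub (hφ.2.differentiable (by simp) x).hasFDerivAt
    have h7 := (hφ.smoothAt_direction x).orthogonalProjectionOnto_fderiv h6
      (Eventually.of_forall fun y => mem_points_through (π y) y) ξ (mem_points_through (π x) x)
    change _ = dirDeriv (fiberAt π) x ξ _ at h7
    rw [h4, zero_apply, sub_apply, h5, sub_zero,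
      Submodule.orthogonalProjectionOnto_eq_zero_iff, Submodule.orthogonal_orthogonal] at h7
    have h8 : ξ ∈ (π x).plane ⊓ (π x).planeᗮ := ⟨h7, hξ⟩
    rwa [Submodule.inf_orthogonal_eq_bot, Submodule.mem_bot] at h8
  refine ⟨fun ξ hξ h => key ξ hξ ?_, ?_⟩
  · rw [h]
    intro hinj
    have : Subsingleton (π x).plane := ⟨fun a b => hinj rfl⟩
    have h1 := (π x).finrank_plane
    rw [Module.finrank_zero_of_subsingleton] at h1
    omega
  · rintro _ ⟨⟨ξ, hξ, rfl⟩, h⟩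
    rw [mem_tangentAt_badCone_iff] at h
    rw [key ξ hξ h, map_zero]
    rfl

theorem exists_fibration_of_isClosed_isConnected (hk : 1 ≤ k)
    (hMs : OrientedAffineGrassmannian.IsSmoothSubmanifold d M)
    (hd : d + k = Module.finrank ℝ V) (hcl : IsClosed M) (hconn : IsConnected M)
    (hM : AlphaTransverse M) :
    ∃ π : V → OrientedGrassmannian k V,
      IsSmoothFibration π ∧ IsNondegenerate π ∧ M = fibers π := by
  choose F hF hFu using existsUnique_mem_points hk hMs hd hcl hconn hM
  have hFu' : ∀ P ∈ M, ∀ x ∈ P.points, F x = P := fun P hP x hx => (hFu x P ⟨hP, hx⟩).symm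
  have hloc : ∀ x, ∃ (f : EuclideanSpace ℝ (Fin d) → OrientedAffineGrassmannian k V)
      (g : V → EuclideanSpace ℝ (Fin d)), OrientedAffineGrassmannian.IsLocalParametrization M f ∧
        ContDiffAt ℝ ∞ g x ∧ ∀ᶠ z in 𝓝 x, F z = f (g z) := by
    intro x
    obtain ⟨f, g, hf, hg, -, hfg⟩ := exists_smooth_plane_through hMs hd hM (hF x).1 (hF x).2
    exact ⟨f, g, hf, hg, hfg.mono fun z hz => hFu' _ (hf.mem _) z hz⟩
  have hsm : ∀ x, SmoothAt (fun z => (F z).direction) x := by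
    intro x
    obtain ⟨f, g, hf, hg, hfg⟩ := hloc x
    refine ((hf.smooth.smoothAt_direction (g x)).comp hg).congr ?_
    filter_upwards [hfg] with z hz
    rw [hz]
  refine ⟨fun x => (F x).direction, ⟨hsm, fun x y hxy => ?_⟩, fun x => ?_, ?_⟩
  · have h1 : y ∈ (F x).points := by
      have h2 := add_mem hxy (hF x).2
      rwa [sub_add_sub_cancel] at h2
    exact congrArg direction (hFu' _ (hF x).1 y h1)
  · refine isNondegenerate_of_alphaTransverse hk hsm hM (fun z => ?_) x
    rw [fiberAt, ← eq_through (hF z).2]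
    exact (hF z).1
  · ext P
    constructor
    · intro hP
      exact ⟨P.foot, P.foot_mem_points, congrArg direction (hFu' P hP _ P.foot_mem_points).symm⟩
    · rintro ⟨x, hx, hPx⟩
      rw [eq_of_mem_points hPx hx (hF x).2]
      exact (hF x).1

end

/-! ### The fibers of a nondegenerate fibration -/

/-- This is the derivative of rescaling a moving vector `(x + a C, 1 + b C)` of `V × ℝ` back to
height 1. -/
theorem hasFDerivAt_inv_one_add_smul {W V : Type*} [NormedAddCommGroup W] [NormedSpace ℝ W]
    [NormedAddCommGroup V] [NormedSpace ℝ V] (a : W →L[ℝ] V) (b : W →L[ℝ] ℝ) (x : V) :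
    HasFDerivAt (fun C => (1 + b C)⁻¹ • (x + a C)) (a - b.smulRight x) 0 := by
  have hb : HasFDerivAt (fun C => 1 + b C) b 0 := b.hasFDerivAt.const_add 1
  have ha : HasFDerivAt (fun C => x + a C) a 0 := a.hasFDerivAt.const_add x
  have h1 : HasFDerivAt (fun C => (1 + b C)⁻¹) (-b) 0 := by
    have h2 := (hasDerivAt_inv (x := 1 + b 0) (by simp)).comp_hasFDerivAt 0 hb
    simp only [map_zero, add_zero, one_pow, inv_one, neg_smul, one_smul] at h2
    exact h2
  have h2 : a - b.smulRight x = (1 + b 0)⁻¹ • a + (-b).smulRight (x + a 0) := by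
    ext D
    simp [sub_eq_add_neg]
  rw [h2]
  exact h1.smul ha

/-- A tangent vector of a set on which `Φ ∘ χ` is the identity is fixed by the derivative. -/
theorem apply_eq_of_mem_tangentConeAt {W V : Type*} [NormedAddCommGroup W] [NormedSpace ℝ W]
    [NormedAddCommGroup V] [NormedSpace ℝ V] {Φ : V → W} {χ : W → V} {x : V} {Φ' : V →L[ℝ] W}
    {L : W →L[ℝ] V} {S T : Set W} {C₀ D : W} (hχ : HasFDerivAt χ L C₀) (hχ₀ : χ C₀ = x)
    (hΦ : HasFDerivAt Φ Φ' x) (hΦ₀ : Φ x = C₀) (hT : T ∈ 𝓝 C₀)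
    (hS : ∀ C ∈ S ∩ T, Φ (χ C) = C) (hD : D ∈ tangentConeAt ℝ S C₀) : Φ' (L D) = D := by
  subst hχ₀
  rw [← tangentConeAt_inter_nhds hT] at hD
  have h1 : HasFDerivAt (fun C => Φ (χ C)) (Φ' ∘L L) C₀ := hΦ.comp C₀ hχ
  have h2 : HasFDerivWithinAt (fun C => Φ (χ C)) (ContinuousLinearMap.id ℝ W) (S ∩ T) C₀ :=
    (hasFDerivWithinAt_id C₀ _).congr hS hΦ₀
  exact h1.hasFDerivWithinAt.unique_on h2 hD

section

variable {k : ℕ} {V : Type*} [NormedAddCommGroup V] [InnerProductSpace ℝ V]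
  [FiniteDimensional ℝ V] {π : V → OrientedGrassmannian k V}

theorem IsSmoothFibration.eq_fiberAt (hπ : IsSmoothFibration π)
    {P : OrientedAffineGrassmannian k V} (hP : P ∈ fibers π) {z : V} (hz : z ∈ P.points) :
    P = fiberAt π z := by
  obtain ⟨x, hx, hPx⟩ := hP
  have h1 : z - x ∈ (π x).plane := by
    have h2 : (z - P.foot) - (x - P.foot) ∈ P.direction.plane := sub_mem hz hx
    rwa [sub_sub_sub_cancel_right, hPx] at h2
  rw [fiberAt, hπ.eq_of_sub_mem x z h1, ← hPx]
  exact eq_through hz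

theorem fiberAt_mem_fibers (π : V → OrientedGrassmannian k V) (x : V) : fiberAt π x ∈ fibers π :=
  ⟨x, mem_points_through _ x, rfl⟩

theorem IsSmoothFibration.range_fiberAt (hπ : IsSmoothFibration π) :
    range (fiberAt π) = fibers π := by
  ext P
  constructor
  · rintro ⟨x, rfl⟩
    exact fiberAt_mem_fibers π x
  · exact fun hP => ⟨P.foot, (hπ.eq_fiberAt hP P.foot_mem_points).symm⟩

theorem IsSmoothFibration.isConnected_fibers (hπ : IsSmoothFibration π) :
    IsConnected (fibers π) := by
  rw [← hπ.range_fiberAt]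
  exact isConnected_range (smooth_fiberAt hπ.smooth).continuous

/-- Whether a plane is a fiber can be tested at its foot, and both sides of the resulting equation
are continuous. -/
theorem IsSmoothFibration.isClosed_fibers (hπ : IsSmoothFibration π) : IsClosed (fibers π) := by
  have h1 : fibers π = {P | P.direction = π P.foot} := by
    ext P
    refine ⟨fun hP => ?_, fun hP => ⟨P.foot, P.foot_mem_points, hP⟩⟩
    exact congrArg direction (hπ.eq_fiberAt hP P.foot_mem_points)
  rw [h1]
  exact isClosed_eq continuous_direction (hπ.smooth.continuous.comp continuous_foot)

/-- The point `(x, 1)` of `α(P)` for a point `x` of `P`. -/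
def liftPoint {P : OrientedAffineGrassmannian k V} {x : V} (hx : x ∈ P.points) : P.alpha.plane :=
  ⟨WithLp.toLp 2 (x, (1 : ℝ)), (P.mem_alpha_plane_iff x).2 hx⟩

/-- The velocity at `x` of a point of a moving affine plane, if `D` is the velocity of the cone. -/
def pointVelocity {P : OrientedAffineGrassmannian k V} {x : V} (hx : x ∈ P.points)
    (D : P.alpha.plane →L[ℝ] P.alpha.planeᗮ) : V :=
  (D (liftPoint hx) : WithLp 2 (V × ℝ)).fst - (D (liftPoint hx) : WithLp 2 (V × ℝ)).snd • x

theorem hasFDerivAt_projected_point {P : OrientedAffineGrassmannian k V} {x : V}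
    (hx : x ∈ P.points) :
    ∃ L : (P.alpha.plane →L[ℝ] P.alpha.planeᗮ) →L[ℝ] V, (∀ D, L D = pointVelocity hx D) ∧
      HasFDerivAt (fun C : P.alpha.plane →L[ℝ] P.alpha.planeᗮ =>
        (1 + (C (liftPoint hx) : WithLp 2 (V × ℝ)).snd)⁻¹ •
          (x + (C (liftPoint hx) : WithLp 2 (V × ℝ)).fst)) L 0 := by
  let ev : (P.alpha.plane →L[ℝ] P.alpha.planeᗮ) →L[ℝ] V × ℝ :=
    ((WithLp.prodContinuousLinearEquiv 2 ℝ V ℝ : WithLp 2 (V × ℝ) →L[ℝ] V × ℝ) ∘L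
      P.alpha.planeᗮ.subtypeL) ∘L ContinuousLinearMap.apply ℝ _ (liftPoint hx)
  let a : (P.alpha.plane →L[ℝ] P.alpha.planeᗮ) →L[ℝ] V := ContinuousLinearMap.fst ℝ V ℝ ∘L ev
  let b : (P.alpha.plane →L[ℝ] P.alpha.planeᗮ) →L[ℝ] ℝ := ContinuousLinearMap.snd ℝ V ℝ ∘L ev
  have h := hasFDerivAt_inv_one_add_smul (W := P.alpha.plane →L[ℝ] P.alpha.planeᗮ) a b x
  exact ⟨a - b.smulRight x, fun D => rfl, h⟩

/-- Every tangent vector of `α(M)`, for the set `M` of fibers, is the velocity of the fiber through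
a moving point. -/
theorem IsSmoothFibration.eq_differential_of_mem_tangentAt (hπ : IsSmoothFibration π) (x : V)
    (hx : x ∈ (fiberAt π x).points)
    {D : (fiberAt π x).alpha.plane →L[ℝ] (fiberAt π x).alpha.planeᗮ}
    (hD : D ∈ tangentAt (alpha '' fibers π) (fiberAt π x).alpha) :
    OrientedGrassmannian.differential (fun y => (fiberAt π y).alpha) x (pointVelocity hx D) =
      D := by
  obtain ⟨L, hL, hχ⟩ := hasFDerivAt_projected_point hx
  set χ : ((fiberAt π x).alpha.plane →L[ℝ] (fiberAt π x).alpha.planeᗮ) → V := fun C =>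
    (1 + (C (liftPoint hx) : WithLp 2 (V × ℝ)).snd)⁻¹ •
      (x + (C (liftPoint hx) : WithLp 2 (V × ℝ)).fst) with hχdef
  have hχ0 : χ 0 = x := by simp [hχdef]
  have hΦ : HasFDerivAt (fun y => (fiberAt π x).alpha.coord (fiberAt π y).alpha)
      (OrientedGrassmannian.differential (fun y => (fiberAt π y).alpha) x) x :=
    ((smooth_fiberAt hπ.smooth).smoothAt_alpha x).hasFDerivAt_coord
  set T : Set ((fiberAt π x).alpha.plane →L[ℝ] (fiberAt π x).alpha.planeᗮ) :=
    {C | 1 + (C (liftPoint hx) : WithLp 2 (V × ℝ)).snd ≠ 0} with hT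
  have hT0 : T ∈ 𝓝 (0 : (fiberAt π x).alpha.plane →L[ℝ] (fiberAt π x).alpha.planeᗮ) := by
    refine IsOpen.mem_nhds ?_ (by simp [hT])
    refine isOpen_ne_fun ?_ continuous_const
    have h1 : Continuous fun C : (fiberAt π x).alpha.plane →L[ℝ] (fiberAt π x).alpha.planeᗮ => (C (liftPoint hx) : WithLp 2 (V × ℝ)) :=
      continuous_subtype_val.comp (by fun_prop)
    exact continuous_const.add (continuous_snd.comp ((WithLp.prod_continuous_ofLp 2 V ℝ).comp h1))
  -- If the graph of `C` is the cone of a fiber `Q`, the vector of this graph over `(x, 1)`,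
  -- rescaled to height 1, is a point `χ C` of `Q`. Hence `Q` is the fiber through `χ C`, and `χ` is
  -- inverted by taking cones of fibers.
  have hS : ∀ C ∈ (fiberAt π x).alpha.graphChart ⁻¹' (alpha '' fibers π) ∩ T,
      (fiberAt π x).alpha.coord (fiberAt π (χ C)).alpha = C := by
    rintro C ⟨⟨Q, hQ, hQC⟩, hCT⟩
    have h1 : (liftPoint hx : WithLp 2 (V × ℝ)) + C (liftPoint hx) ∈ Q.alpha.plane := by
      rw [hQC]
      exact mem_graphChart_plane.2 ⟨_, rfl⟩
    have h2 := Q.alpha.plane.smul_mem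
      (1 + (C (liftPoint hx) : WithLp 2 (V × ℝ)).snd)⁻¹ h1
    have h3 : (1 + (C (liftPoint hx) : WithLp 2 (V × ℝ)).snd)⁻¹ •
        ((liftPoint hx : WithLp 2 (V × ℝ)) + C (liftPoint hx)) = WithLp.toLp 2 (χ C, (1 : ℝ)) := by
      refine WithLp.ofLp_injective 2 (Prod.ext rfl ?_)
      exact inv_mul_cancel₀ hCT
    rw [h3, mem_alpha_plane_iff] at h2
    rw [← hπ.eq_fiberAt hQ h2, hQC, coord_graphChart]
  rw [← hL]
  exact apply_eq_of_mem_tangentConeAt hχ hχ0 hΦ (coord_self _) hT0 hS hD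

theorem IsSmoothFibration.alphaTransverse_fibers (hπ : IsSmoothFibration π)
    (hnd : IsNondegenerate π) : AlphaTransverse (fibers π) := by
  have hφ := smooth_fiberAt hπ.smooth
  rw [alphaTransverse_iff]
  intro P hP D hD hninj
  rw [injective_iff_map_eq_zero] at hninj
  push Not at hninj
  obtain ⟨p, hp, hp0⟩ := hninj
  obtain ⟨t, s, rfl⟩ := exists_conePoint p
  rw [ne_eq, conePoint_eq_zero] at hp0
  -- At height 0 the killed vector is a direction of `P`, and the foot is the point to follow.
  by_cases hs : s = 0
  · subst hs
    have hP' := hπ.eq_fiberAt hP P.foot_mem_points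
    obtain ⟨x, hx⟩ : ∃ x, x = P.foot := ⟨_, rfl⟩
    rw [← hx] at hP'
    subst hP'
    have hxx : x ∈ (fiberAt π x).points := mem_points_through _ x
    have hxo : x ∈ (fiberAt π x).direction.planeᗮ := by
      have h1 := (fiberAt π x).foot_mem
      rwa [← hx] at h1
    have h1 := hπ.eq_differential_of_mem_tangentAt x hxx hD
    have h2 := (hφ.differential_alpha_eq_zero_iff x t 0 (pointVelocity hxx D)).1 (by rw [h1, hp])
    rw [velocity_apply, zero_smul, add_zero] at h2
    have h3 : (dirDeriv (fiberAt π) x (pointVelocity hxx D) t : V) ∈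
        (fiberAt π x).direction.plane ⊓ (fiberAt π x).direction.planeᗮ :=
      ⟨h2, (dirDeriv (fiberAt π) x (pointVelocity hxx D) t).2⟩
    rw [Submodule.inf_orthogonal_eq_bot, Submodule.mem_bot] at h3
    have h4 : ¬ Function.Injective (dirDeriv (fiberAt π) x (pointVelocity hxx D)) := fun hinj =>
      hp0 ⟨hinj ((Subtype.ext h3).trans (map_zero _).symm), rfl⟩
    -- The values of `D` are orthogonal to `α(P)`, in particular to its horizontal vectors, and the
    -- correction from rescaling is a multiple of the foot, which is also normal.
    have h5 : pointVelocity hxx D ∈ (fiberAt π x).direction.planeᗮ := by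
      refine sub_mem ?_ (Submodule.smul_mem _ _ hxo)
      rw [Submodule.mem_orthogonal]
      intro z hz
      have h6 := Submodule.inner_right_of_mem_orthogonal (horizontal_mem_alpha_plane.2 hz)
        (D (liftPoint hxx)).2
      rw [WithLp.prod_inner_apply] at h6
      simpa [horizontal_apply] using h6
    have h6 : dirDeriv (fiberAt π) x (pointVelocity hxx D) = 0 :=
      (hnd x).2 ⟨⟨_, h5, rfl⟩, mem_tangentAt_badCone_iff.2 h4⟩
    have h7 : pointVelocity hxx D = 0 := (hnd x).1 _ h5 h6
    rw [← h1, h7, map_zero]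
  -- Rescaled to height 1, the killed vector becomes a point `x` of `P`. Following this `x`, which
  -- has velocity 0, gives `D = 0`.
  · obtain ⟨x, hxP, hDx⟩ : ∃ x, ∃ hx : x ∈ P.points, D (liftPoint hx) = 0 := by
      have hx : P.foot + s⁻¹ • (t : V) ∈ P.points := by
        rw [points, mem_ofPred_eq, add_sub_cancel_left]
        exact Submodule.smul_mem _ _ t.2
      refine ⟨_, hx, ?_⟩
      have h1 : liftPoint hx = s⁻¹ • P.conePoint t s := by
        refine Subtype.ext (WithLp.ofLp_injective 2 (Prod.ext ?_ ?_))
        · change P.foot + s⁻¹ • (t : V) = s⁻¹ • ((t : V) + s • P.foot)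
          rw [smul_add, inv_smul_smul₀ hs, add_comm]
        · exact (inv_mul_cancel₀ hs).symm
      rw [h1, map_smul, hp, smul_zero]
    clear hp0 hp t
    have hP' := hπ.eq_fiberAt hP hxP
    subst hP'
    rw [← hπ.eq_differential_of_mem_tangentAt x hxP hD]
    have h1 : pointVelocity hxP D = 0 := by
      rw [pointVelocity, hDx]
      simp
    rw [h1, map_zero]

end

/-! ### Transverse fibrations are skew, and sections over their sets of directions -/

section

variable {k d : ℕ} {V : Type*} [NormedAddCommGroup V] [InnerProductSpace ℝ V]
  [FiniteDimensional ℝ V] {M : Set (OrientedAffineGrassmannian k V)}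

/-- Two planes of a transverse family of disjoint planes have no common direction. -/
theorem eq_of_common_direction (hMs : OrientedAffineGrassmannian.IsSmoothSubmanifold d M)
    (hd : d + k = Module.finrank ℝ V) (hM : AlphaTransverse M)
    (hdisj : ∀ P ∈ M, ∀ Q ∈ M, ∀ x, x ∈ P.points → x ∈ Q.points → P = Q)
    {P Q : OrientedAffineGrassmannian k V} (hP : P ∈ M) (hQ : Q ∈ M) {e : V} (he : e ≠ 0)
    (heP : e ∈ P.direction.plane) (heQ : e ∈ Q.direction.plane) : P = Q := by
  by_contra hne
  obtain ⟨N, N', hN, hN', hPN, hQN, hNN⟩ := t2_separation hne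
  have h1 := eventually_exists_mem_cone hMs hd hM hP (x := e) (s := 0)
    (by rwa [zero_smul, sub_zero]) (fun h => he h.1) (hN.mem_nhds hPN)
  have h2 := eventually_exists_mem_cone hMs hd hM hQ (x := e) (s := 0)
    (by rwa [zero_smul, sub_zero]) (fun h => he h.1) (hN'.mem_nhds hQN)
  have hc : Tendsto (fun s : ℝ => (e, s)) (𝓝[≠] 0) (𝓝 (e, 0)) :=
    (Continuous.prodMk_right e).continuousAt.tendsto.mono_left nhdsWithin_le_nhds
  -- Near the common point at infinity `(e, 0)`, a vector `(e, s)` with `s ≠ 0` lies on the cone of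
  -- a plane near `P` and on that of a plane near `Q`. Both planes contain the finite point `s⁻¹ e`,
  -- so they coincide.
  obtain ⟨s, ⟨⟨P', hP', hPN', hPs⟩, ⟨Q', hQ', hQN', hQs⟩⟩, hs⟩ :=
    ((hc.eventually (h1.and h2)).and (eventually_mem_nhdsWithin (a := (0 : ℝ)))).exists
  have hmem : ∀ R : OrientedAffineGrassmannian k V, e - s • R.foot ∈ R.direction.plane →
      s⁻¹ • e ∈ R.points := by
    intro R hR
    have h3 := R.direction.plane.smul_mem s⁻¹ hR
    rwa [smul_sub, inv_smul_smul₀ hs] at h3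
  obtain rfl := hdisj P' hP' Q' hQ' _ (hmem P' hPs) (hmem Q' hQs)
  exact Set.disjoint_left.1 hNN hPN' hQN'

/-- The plane of a skew transverse family depends continuously on its direction. -/
theorem eventually_mem_of_direction (hk : 1 ≤ k)
    (hMs : OrientedAffineGrassmannian.IsSmoothSubmanifold d M)
    (hd : d + k = Module.finrank ℝ V) (hM : AlphaTransverse M)
    (hdisj : ∀ P ∈ M, ∀ Q ∈ M, ∀ x, x ∈ P.points → x ∈ Q.points → P = Q)
    {P : OrientedAffineGrassmannian k V} (hP : P ∈ M) {N : Set (OrientedAffineGrassmannian k V)}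
    (hN : N ∈ 𝓝 P) : ∀ᶠ u in 𝓝 P.direction, ∀ Q ∈ M, Q.direction = u → Q ∈ N := by
  obtain ⟨e, he, he0⟩ := P.direction.exists_ne_zero hk
  have h1 := eventually_exists_mem_cone hMs hd hM hP (x := e) (s := 0)
    (by rwa [zero_smul, sub_zero]) (fun h => he0 h.1) hN
  -- For `u` near the direction of `P`, the projection of `e` to `u` is nonzero and close to `e`.
  -- Hence it is a direction of some plane of `M` in `N`, and a plane of `M` over `u` shares it.
  have hc : ContinuousAt (fun u : OrientedGrassmannian k V => u.plane.starProjection e)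
      P.direction := (continuous_starProjection.clm_apply continuous_const).continuousAt
  have hPe : P.direction.plane.starProjection e = e := mem_plane_iff_starProjection.1 he
  have hc' : Tendsto (fun u : OrientedGrassmannian k V => (u.plane.starProjection e, (0 : ℝ)))
      (𝓝 P.direction) (𝓝 (e, 0)) := by
    have h2 := (hc.prodMk continuousAt_const : ContinuousAt (fun u : OrientedGrassmannian k V =>
      (u.plane.starProjection e, (0 : ℝ))) P.direction)
    rw [ContinuousAt, hPe] at h2
    exact h2
  have h2 : ∀ᶠ u : OrientedGrassmannian k V in 𝓝 P.direction, u.plane.starProjection e ≠ 0 :=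
    hc.eventually_ne (by rwa [hPe])
  filter_upwards [hc'.eventually h1, h2] with u hu hu0 Q hQ hQu
  obtain ⟨P', hP', hPN', hPu⟩ := hu
  rw [zero_smul, sub_zero] at hPu
  rwa [eq_of_common_direction hMs hd hM hdisj hQ hP' hu0
    (hQu ▸ Submodule.starProjection_apply_mem _ _) hPu]

end

section

variable {k d : ℕ} {V : Type*} [NormedAddCommGroup V] [InnerProductSpace ℝ V]
  [FiniteDimensional ℝ V] {M : Set (OrientedAffineGrassmannian k V)}

theorem isEmbedding_direction (hk : 1 ≤ k)
    (hMs : OrientedAffineGrassmannian.IsSmoothSubmanifold d M)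
    (hd : d + k = Module.finrank ℝ V) (hM : AlphaTransverse M)
    (hdisj : ∀ P ∈ M, ∀ Q ∈ M, ∀ x, x ∈ P.points → x ∈ Q.points → P = Q) :
    IsEmbedding (fun P : M => P.1.direction) := by
  refine ⟨isInducing_iff_nhds.2 fun P => le_antisymm ?_ ?_, fun P Q h => ?_⟩
  · exact (continuous_direction.comp continuous_subtype_val).continuousAt.tendsto.le_comap
  · intro S hS
    rw [nhds_subtype_eq_comap, mem_comap] at hS
    obtain ⟨N, hN, hNS⟩ := hS
    exact ⟨_, eventually_mem_of_direction hk hMs hd hM hdisj P.2 hN,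
      fun Q hQ => hNS (hQ Q.1 Q.2 rfl)⟩
  · obtain ⟨e, he, he0⟩ := P.1.direction.exists_ne_zero hk
    have h' : P.1.direction = Q.1.direction := h
    exact Subtype.ext (eq_of_common_direction hMs hd hM hdisj P.2 Q.2 he0 he (h' ▸ he))

/-- The directions of a local parametrization of `M` form a local parametrization. -/
theorem isLocalParametrization_direction (hk : 1 ≤ k)
    (hMs : OrientedAffineGrassmannian.IsSmoothSubmanifold d M)
    (hd : d + k = Module.finrank ℝ V) (hM : AlphaTransverse M)
    (hdisj : ∀ P ∈ M, ∀ Q ∈ M, ∀ x, x ∈ P.points → x ∈ Q.points → P = Q)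
    {f : EuclideanSpace ℝ (Fin d) → OrientedAffineGrassmannian k V}
    (hf : OrientedAffineGrassmannian.IsLocalParametrization M f) :
    OrientedGrassmannian.IsLocalParametrization (direction '' M) (fun y => (f y).direction) := by
  have hemb := isEmbedding_direction hk hMs hd hM hdisj
  refine ⟨hf.smooth.1, fun y => ?_, ?_, ?_⟩
  · rw [injective_iff_map_eq_zero]
    intro η hη
    by_contra hη0
    obtain ⟨e, he, he0⟩ := (f y).direction.exists_ne_zero hk
    have h1 : ¬ ((⟨e, he⟩ : (f y).direction.plane) = 0 ∧ (0 : ℝ) = 0) :=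
      fun h => he0 (congrArg Subtype.val h.1)
    refine velocity_notMem hM hf.smooth hf.mem (hf.immersion y) hη0 h1 ?_
    have h2 : dirDeriv f y η = 0 := hη
    rw [velocity_apply, h2, zero_smul, add_zero]
    exact zero_mem _
  · exact hemb.comp (hf.isEmbedding.codRestrict M hf.mem)
  · obtain ⟨O, hO, hrange⟩ := hf.range_eq
    obtain ⟨O', hO', hOO'⟩ := hemb.isInducing.isOpen_iff.1 (hO.preimage continuous_subtype_val)
    have hmem : ∀ P ∈ M, P ∈ O ↔ P.direction ∈ O' := fun P hP =>
      (Set.ext_iff.1 hOO' ⟨P, hP⟩).symm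
    refine ⟨O', hO', ?_⟩
    ext u
    constructor
    · rintro ⟨y, rfl⟩
      have h1 : f y ∈ M ∩ O := hrange ▸ mem_range_self y
      exact ⟨⟨_, h1.1, rfl⟩, (hmem _ h1.1).1 h1.2⟩
    · rintro ⟨⟨P, hP, rfl⟩, hu⟩
      obtain ⟨y, rfl⟩ : P ∈ range f := hrange ▸ ⟨hP, (hmem P hP).2 hu⟩
      exact ⟨y, rfl⟩

theorem ContractibleSpace.of_retract {X Y : Type*} [TopologicalSpace X] [TopologicalSpace Y]
    [ContractibleSpace X] (i : C(Y, X)) (r : C(X, Y)) (h : ∀ y, r (i y) = y) :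
    ContractibleSpace Y := by
  rw [contractible_iff_id_nullhomotopic]
  have h1 := ((id_nullhomotopic X).comp_right r).comp_left i
  convert h1 using 1
  ext y
  exact (h y).symm

/-- Near a point of the set of directions, its closure consists of directions. -/
theorem exists_isOpen_closure_subset (hk : 1 ≤ k)
    (hMs : OrientedAffineGrassmannian.IsSmoothSubmanifold d M)
    (hd : d + k = Module.finrank ℝ V) (hM : AlphaTransverse M)
    (hdisj : ∀ P ∈ M, ∀ Q ∈ M, ∀ x, x ∈ P.points → x ∈ Q.points → P = Q)
    {P : OrientedAffineGrassmannian k V} (hP : P ∈ M) :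
    ∃ O, IsOpen O ∧ P.direction ∈ O ∧ closure (direction '' M) ∩ O ⊆ direction '' M := by
  obtain ⟨f, y, hf, rfl⟩ := hMs.exists_parametrization hP
  have h1 := hf.eventually_exists (Metric.closedBall_mem_nhds y zero_lt_one)
  -- A compact, hence closed, piece of the set of directions which contains all directions near that
  -- of `f y`.
  set K := (fun z => (f z).direction) '' Metric.closedBall y 1 with hK
  have hKc : IsClosed K :=
    ((isCompact_closedBall y 1).image (continuous_direction.comp hf.smooth.continuous)).isClosed
  have h2 : ∀ᶠ u in 𝓝 (f y).direction, u ∈ direction '' M → u ∈ K := by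
    filter_upwards [eventually_mem_of_direction hk hMs hd hM hdisj hP h1] with u hu
    rintro ⟨Q, hQ, rfl⟩
    obtain ⟨z, rfl, hz⟩ := hu Q hQ rfl hQ
    exact ⟨z, hz, rfl⟩
  obtain ⟨O, hO, hOo, hPO⟩ := mem_nhds_iff.1 h2
  refine ⟨O, hOo, hPO, ?_⟩
  have h3 : closure (direction '' M) ∩ O ⊆ closure (direction '' M ∩ O) := hOo.closure_inter
  have h4 : closure (direction '' M ∩ O) ⊆ K :=
    closure_minimal (fun u hu => hO hu.2 hu.1) hKc
  rintro u hu
  obtain ⟨z, -, rfl⟩ := h4 (h3 hu)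
  exact ⟨_, hf.mem z, rfl⟩

/-- Otherwise a subsequence has bounded feet and, by compactness, converges to a plane of the closed
set `M`. Its directions then converge to a point of the set of directions, which is locally closed,
and so stay away from the boundary. -/
theorem tendsto_norm_foot_atTop (hk : 1 ≤ k)
    (hMs : OrientedAffineGrassmannian.IsSmoothSubmanifold d M)
    (hd : d + k = Module.finrank ℝ V) (hcl : IsClosed M) (hM : AlphaTransverse M)
    (hdisj : ∀ P ∈ M, ∀ Q ∈ M, ∀ x, x ∈ P.points → x ∈ Q.points → P = Q)
    {P : ℕ → OrientedAffineGrassmannian k V} (hP : ∀ i, P i ∈ M)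
    (hlim : Tendsto (fun i => (P i).direction) atTop
      (nhdsSet (closure (direction '' M) \ direction '' M))) :
    Tendsto (fun i => ‖(P i).foot‖) atTop atTop := by
  have := compactSpace (V := V) hk
  have : ProperSpace V := FiniteDimensional.proper_real V
  by_contra hnot
  obtain ⟨R, hR⟩ : ∃ R : ℝ, ∃ᶠ i in atTop, ‖(P i).foot‖ < R := by
    rw [tendsto_atTop] at hnot
    push Not at hnot
    obtain ⟨R, hR⟩ := hnot
    exact ⟨R, hR.mono fun i hi => by simpa using hi⟩
  obtain ⟨φ, hφ, hφR⟩ := extraction_of_frequently_atTop hR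
  have hcpt : IsCompact ((univ : Set (OrientedGrassmannian k V)) ×ˢ Metric.closedBall (0 : V) R) :=
    isCompact_univ.prod (isCompact_closedBall 0 R)
  obtain ⟨⟨u, v⟩, -, ψ, hψ, huv⟩ := hcpt.isSeqCompact
    (x := fun i => ((P (φ i)).direction, (P (φ i)).foot))
    (fun i => ⟨mem_univ _, mem_closedBall_zero_iff.2 (hφR i).le⟩)
  have h1 : Tendsto (fun i => P (φ (ψ i))) atTop (𝓝 (through u v)) := by
    have h2 := (continuous_through.tendsto (u, v)).comp huv
    refine h2.congr fun i => ?_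
    exact (eq_through (P (φ (ψ i))).foot_mem_points).symm
  have h2 : through u v ∈ M := hcl.mem_of_tendsto h1 (Eventually.of_forall fun i => hP _)
  obtain ⟨O, hO, huO, hOU⟩ := exists_isOpen_closure_subset hk hMs hd hM hdisj h2
  obtain ⟨C, hC, hCc, hCO⟩ := exists_mem_nhds_isClosed_subset (hO.mem_nhds huO)
  have h3 : Cᶜ ∈ nhdsSet (closure (direction '' M) \ direction '' M) := by
    refine hCc.isOpen_compl.mem_nhdsSet.2 ?_
    rintro w ⟨hw, hw'⟩ hwC
    exact hw' (hOU ⟨hw, hCO hwC⟩)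
  have h4 : Tendsto (fun i => (P (φ (ψ i))).direction) atTop (𝓝 (through u v).direction) :=
    (continuous_direction.tendsto _).comp h1
  obtain ⟨i, hi, hi'⟩ := ((h4.eventually hC).and
    ((hφ.tendsto_atTop.comp hψ.tendsto_atTop).eventually (hlim.eventually h3))).exists
  exact hi' hi

/-- A nondegenerate fibration is given by a section over a contractible set of directions. -/
theorem exists_section_of_fibration (hk : 1 ≤ k)
    (hMs : OrientedAffineGrassmannian.IsSmoothSubmanifold d M)
    (hd : d + k = Module.finrank ℝ V) {π : V → OrientedGrassmannian k V}
    (hπ : IsSmoothFibration π) (hnd : IsNondegenerate π) (hMπ : M = fibers π) :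
    ∃ (U : Set (OrientedGrassmannian k V)) (s : U → OrientedAffineGrassmannian k V),
      OrientedGrassmannian.IsSmoothSubmanifold d U ∧ IsConnected U ∧ ContractibleSpace U ∧
      IsSmoothSection d U s ∧ M = range s ∧ AlphaTransverse M ∧
      ∀ u : ℕ → U, Tendsto (fun i => (u i : OrientedGrassmannian k V)) atTop
        (nhdsSet (closure U \ U)) → Tendsto (fun i => ‖(s (u i)).foot‖) atTop atTop := by
  have hM : AlphaTransverse M := hMπ ▸ hπ.alphaTransverse_fibers hnd
  have hcl : IsClosed M := hMπ ▸ hπ.isClosed_fibers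
  have hconn : IsConnected M := hMπ ▸ hπ.isConnected_fibers
  have hdisj : ∀ P ∈ M, ∀ Q ∈ M, ∀ x, x ∈ P.points → x ∈ Q.points → P = Q := by
    intro P hP Q hQ x hx hx'
    rw [hMπ] at hP hQ
    rw [hπ.eq_fiberAt hP hx, hπ.eq_fiberAt hQ hx']
  have hemb := isEmbedding_direction hk hMs hd hM hdisj
  have hparam := fun f hf => isLocalParametrization_direction hk hMs hd hM hdisj (f := f) hf
  choose s hsM hs using fun u : direction '' M => u.2
  have hs_eq : ∀ P (hP : P ∈ M), s ⟨P.direction, P, hP, rfl⟩ = P := fun P hP =>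
    congrArg Subtype.val (hemb.injective (a₁ := ⟨_, hsM _⟩) (a₂ := ⟨P, hP⟩) (hs _))
  have hs_cont : Continuous s := by
    refine continuous_iff_continuousAt.2 fun u N hN => ?_
    rw [mem_map]
    have h1 := eventually_mem_of_direction hk hMs hd hM hdisj (hsM u) hN
    rw [hs u] at h1
    filter_upwards [continuous_subtype_val.continuousAt.eventually h1] with w hw
    exact hw _ (hsM w) (hs w)
  refine ⟨direction '' M, s, ?_, hconn.image _ continuous_direction.continuousOn, ?_, ?_, ?_, hM, ?_⟩
  · rintro _ ⟨P, hP, rfl⟩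
    obtain ⟨f, y, hf, rfl⟩ := hMs.exists_parametrization hP
    exact ⟨_, hparam f hf, y, rfl⟩
  · have hmem : ∀ x, π x ∈ direction '' M := fun x =>
      ⟨fiberAt π x, hMπ ▸ fiberAt_mem_fibers π x, rfl⟩
    -- The foot embeds the set of directions in `V`, and `π` retracts `V` onto it.
    refine ContractibleSpace.of_retract (X := V) ⟨fun u => (s u).foot, continuous_foot.comp hs_cont⟩
      ⟨fun x => ⟨π x, hmem x⟩, hπ.smooth.continuous.subtype_mk _⟩ fun u => Subtype.ext ?_
    change π (s u).foot = u
    rw [← hs u]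
    exact (congrArg direction (hπ.eq_fiberAt (hMπ ▸ hsM u) (s u).foot_mem_points)).symm
  · refine ⟨hs, fun u => ?_⟩
    obtain ⟨f, y, hf, hy⟩ := hMs.exists_parametrization (hsM u)
    refine ⟨fun z => ⟨(f z).direction, f z, hf.mem z, rfl⟩, hparam f hf, ⟨y, ?_⟩, ?_⟩
    · refine Subtype.ext ?_
      change (f y).direction = u
      rw [hy, hs]
    · simp only [hs_eq _ (hf.mem _)]
      exact hf.smooth
  · ext P
    constructor
    · exact fun hP => ⟨_, hs_eq P hP⟩
    · rintro ⟨u, rfl⟩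
      exact hsM u
  · intro u hu
    refine tendsto_norm_foot_atTop hk hMs hd hcl hM hdisj (fun i => hsM (u i)) ?_
    simpa only [hs] using hu

/-! ### From a section with growth at the boundary to a closed family -/

theorem IsSmoothSection.continuous {U : Set (OrientedGrassmannian k V)}
    {s : U → OrientedAffineGrassmannian k V} (hs : IsSmoothSection d U s) : Continuous s := by
  refine continuous_iff_continuousAt.2 fun u => ?_
  obtain ⟨f, hf, ⟨y, rfl⟩, hsf⟩ := hs.smooth u
  obtain ⟨O, hO, hrange⟩ := hf.range_eq
  have hemb : IsEmbedding f := IsEmbedding.of_comp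
    (continuous_induced_rng.2 hf.smooth.continuous) continuous_subtype_val hf.isEmbedding
  have hopen : IsOpen (range f) := by
    refine ⟨O, hO, ?_⟩
    ext u
    constructor
    · intro hu
      obtain ⟨z, hz⟩ : (u : OrientedGrassmannian k V) ∈ range fun y => (f y).1 :=
        hrange ▸ ⟨u.2, hu⟩
      exact ⟨z, Subtype.ext hz⟩
    · rintro ⟨z, rfl⟩
      exact (hrange ▸ mem_range_self z : (f z : OrientedGrassmannian k V) ∈ U ∩ O).2
  exact (IsOpenEmbedding.continuousAt_iff ⟨hemb, hopen⟩).1 hsf.continuous.continuousAt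

/-- For a convergent sequence of planes of the section, a limit direction in `U` gives a limit plane
in the image by continuity. A limit direction in `∂U` would send the feet to infinity, although they
converge. -/
theorem IsSmoothSection.isClosed_range {U : Set (OrientedGrassmannian k V)}
    {s : U → OrientedAffineGrassmannian k V} (hs : IsSmoothSection d U s)
    (hlim : ∀ u : ℕ → U, Tendsto (fun i => (u i : OrientedGrassmannian k V)) atTop
        (nhdsSet (closure U \ U)) → Tendsto (fun i => ‖(s (u i)).foot‖) atTop atTop) :
    IsClosed (range s) := by
  rw [← isSeqClosed_iff_isClosed]
  intro P Q hP hPQ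
  choose u hu using hP
  have h1 : Tendsto (fun i => (u i : OrientedGrassmannian k V)) atTop (𝓝 Q.direction) := by
    refine ((continuous_direction.tendsto Q).comp hPQ).congr fun i => ?_
    rw [Function.comp_apply, ← hu, hs.direction_eq]
  have h2 : Tendsto (fun i => (s (u i)).foot) atTop (𝓝 Q.foot) := by
    refine ((continuous_foot.tendsto Q).comp hPQ).congr fun i => ?_
    rw [Function.comp_apply, ← hu]
  have hcl : Q.direction ∈ closure U :=
    mem_closure_of_tendsto h1 (Eventually.of_forall fun i => (u i).2)
  by_cases hQ : Q.direction ∈ U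
  · refine ⟨⟨_, hQ⟩, ?_⟩
    have h3 : Tendsto u atTop (𝓝 ⟨Q.direction, hQ⟩) := tendsto_subtype_rng.2 h1
    have h4 := (hs.continuous.tendsto _).comp h3
    refine tendsto_nhds_unique h4 (hPQ.congr fun i => ?_)
    rw [Function.comp_apply, hu]
  · have h3 := hlim u (h1.mono_right (nhds_le_nhdsSet ⟨hcl, hQ⟩))
    exact absurd h3 (not_tendsto_atTop_of_tendsto_nhds h2.norm)

end

end

/-! ### The equivalence of the three conditions -/

theorem mainTheorem5 (n k : ℕ) (hk : 1 ≤ k) (hkn : k ≤ n)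
    (M : Set (OrientedAffineGrassmannian k (EuclideanSpace ℝ (Fin n))))
    (hM : OrientedAffineGrassmannian.IsSmoothSubmanifold (n - k) M) :
    List.TFAE
      [ -- (a)
        ∃ π : EuclideanSpace ℝ (Fin n) → OrientedGrassmannian k (EuclideanSpace ℝ (Fin n)),
          IsSmoothFibration π ∧ IsNondegenerate π ∧ M = fibers π,
        -- (b)
        IsClosed M ∧ IsConnected M ∧ AlphaTransverse M,
        -- (c)
        ∃ (U : Set (OrientedGrassmannian k (EuclideanSpace ℝ (Fin n)))) (d : ℕ)
          (s : U → OrientedAffineGrassmannian k (EuclideanSpace ℝ (Fin n))),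
          OrientedGrassmannian.IsSmoothSubmanifold d U ∧ IsConnected U ∧ ContractibleSpace U ∧
          IsSmoothSection d U s ∧ M = Set.range s ∧ AlphaTransverse M ∧
          ∀ u : ℕ → U,
            Filter.Tendsto (fun i => (u i : OrientedGrassmannian k (EuclideanSpace ℝ (Fin n))))
              Filter.atTop (nhdsSet (closure U \ U)) →
            Filter.Tendsto (fun i => ‖(s (u i)).foot‖) Filter.atTop Filter.atTop ] := by
  have hd : n - k + k = Module.finrank ℝ (EuclideanSpace ℝ (Fin n)) := by
    rw [finrank_euclideanSpace_fin, Nat.sub_add_cancel hkn]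
  tfae_have 1 → 2 := by
    rintro ⟨π, hπ, hnd, rfl⟩
    exact ⟨hπ.isClosed_fibers, hπ.isConnected_fibers, hπ.alphaTransverse_fibers hnd⟩
  tfae_have 2 → 1 := by
    rintro ⟨hcl, hconn, hMt⟩
    exact exists_fibration_of_isClosed_isConnected hk hM hd hcl hconn hMt
  tfae_have 1 → 3 := by
    rintro ⟨π, hπ, hnd, hMπ⟩
    obtain ⟨U, s, h⟩ := exists_section_of_fibration hk hM hd hπ hnd hMπ
    exact ⟨U, n - k, s, h⟩
  tfae_have 3 → 2 := by
    rintro ⟨U, d, s, -, hU, -, hs, rfl, hMt, hlim⟩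
    have : ConnectedSpace U := isConnected_iff_connectedSpace.1 hU
    exact ⟨hs.isClosed_range hlim, isConnected_range hs.continuous, hMt⟩
  tfae_finish
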